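/- Let $\epsilon_1,\epsilon_2\in\{1,-1\}$ and $\delta_1,\delta_2\in\mathbb R$, and consider the Davey–Stewartson system $$i\psi_t+\psi_{xx}+\epsilon_1\psi_{yy}=\epsilon_2|\psi|^2\psi+\psi\varphi_y,\qquad \varphi_{xx}+\delta_1\varphi_{yy}=\delta_2(|\psi|^2)_y,$$ with $\psi=u+iv$ and real $u,v,\varphi$. Its symmetry algebra $L$ is the set of smooth vector fields on the space $\mathbb R^6$ of the variables $(t,x,y,u,v,\varphi)$ whose second prolongation annihilates the system at every second-order jet satisfying it. For $\tau,\alpha,\beta,\mu,\gamma,\delta\in C^\infty(\mathbb R)$ (functions of $t$; dots are $t$-derivatives) put $$\begin{aligned} \mathcal X(\tau)&=\tau\partial_t+\tfrac{\dot\tau}{2}(x\partial_x+y\partial_y-u\partial_u-v\partial_v-\varphi\partial_\varphi)-\tfrac{x^2+\epsilon_1y^2}{8}\ddot\tau\,(v\partial_u-u\partial_v)-\tfrac{\dddot\tau}{8}\bigl(x^2y+\tfrac{\epsilon_1}{3}y^3\bigr)\partial_\varphi,\\ \mathcal Y(\alpha)&=\alpha\partial_x-\tfrac x2\dot\alpha\,(v\partial_u-u\partial_v)-\tfrac{xy}{2}\ddot\alpha\,\partial_\varphi,\\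 \mathcal Z(\beta)&=\beta\partial_y-\tfrac{y}{2\epsilon_1}\dot\beta\,(v\partial_u-u\partial_v)+\tfrac{\ddot\beta}{4\epsilon_1}(\delta_1x^2-y^2)\partial_\varphi,\\ \mathcal W(\mu)&=\mu(v\partial_u-u\partial_v)+y\dot\mu\,\partial_\varphi,\qquad \mathcal R(\gamma)=x\gamma\,\partial_\varphi,\qquad \mathcal S(\delta)=\delta\,\partial_\varphi . \end{aligned}$$ Then: (1) $L$ is a Lie algebra under the commutator of vector fields, and it consists exactly of the vector fields $\mathcal X(\tau)+\mathcal Y(\alpha)+\mathcal Z(\beta)+\mathcal W(\mu)+\mathcal R(\gamma)+\mathcal S(\delta)$ with $(\epsilon_1+\delta_1)\dddot\tau=0$; the six functions are determined by the vector field. Hence $\tau$ is arbitrary if $\delta_1=-\epsilon_1$, while $\tau$ is exactly a quadratic $\tau_2t^2+\tau_1t+\tau_0$ if $\delta_1\ne-\epsilon_1$. (2) For all $\tau,\tau_1,\tau_2$ satisfying this restriction and all other functions, $$\begin{aligned} &[\mathcal X(\tau_1),\mathcal X(\tau_2)]=\mathcal X(\tau_1\dot\tau_2-\dot\tau_1\tau_2),&&[\mathcal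 X(\tau),\mathcal Y(\alpha)]=\mathcal Y(\tau\dot\alpha-\tfrac12\dot\tau\alpha),\\ &[\mathcal X(\tau),\mathcal Z(\beta)]=\mathcal Z(\tau\dot\beta-\tfrac12\dot\tau\beta),&&[\mathcal X(\tau),\mathcal W(\mu)]=\mathcal W(\tau\dot\mu),\\ &[\mathcal X(\tau),\mathcal R(\gamma)]=\mathcal R(\tau\dot\gamma+\dot\tau\gamma),&&[\mathcal X(\tau),\mathcal S(\delta)]=\mathcal S(\tau\dot\delta+\tfrac12\dot\tau\delta),\\ &[\mathcal Y(\alpha_1),\mathcal Y(\alpha_2)]=-\tfrac12\mathcal W(\alpha_1\dot\alpha_2-\dot\alpha_1\alpha_2),&&[\mathcal Z(\beta_1),\mathcal Z(\beta_2)]=-\tfrac{\epsilon_1}2\mathcal W(\beta_1\dot\beta_2-\dot\beta_1\beta_2),\\ &[\mathcal Y(\alpha),\mathcal Z(\beta)]=\tfrac12\mathcal R(\ddot\alpha\beta+\delta_1\epsilon_1\alpha\ddot\beta),&&[\mathcal Y(\alpha),\mathcal R(\gamma)]=\mathcal S(\alpha\gamma),\\ &[\mathcal Z(\beta),\mathcal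 W(\mu)]=\mathcal S(\beta\dot\mu), \end{aligned}$$ and all other commutators of the generators vanish. (3) If $\delta_1=-\epsilon_1$, then $L$ is infinite-dimensional and has the Levi decomposition $$L=\{\mathcal X(\tau)\}\ltimes\{\mathcal Y(\alpha),\mathcal Z(\beta),\mathcal W(\mu),\mathcal R(\gamma),\mathcal S(\delta)\},$$ that is, $\mathfrak s=\{\mathcal X(\tau)\}$ is a subalgebra without nonzero solvable ideals, $\mathfrak n=\{\mathcal Y(\alpha)+\mathcal Z(\beta)+\mathcal W(\mu)+\mathcal R(\gamma)+\mathcal S(\delta)\}$ is a solvable ideal and the radical of $L$, and $L=\mathfrak s\oplus\mathfrak n$ as a vector space. Moreover $L$ is of (centreless) Kac–Moody–Virasoro type: for some $n$ it embeds as a Lie algebra into the semidirect sum of the Virasoro algebra of vector fields $\tau(t)\,d/dt$, $\tau\in C^\infty(\mathbb R)$, and the current algebra $\mathfrak{sl}(n,\mathbb R)\otimes C^\infty(\mathbb R)$, on which $\tau\,d/dt$ acts by $A\mapsto\tau\dot A$, in such a way that the projection to the Virasoro algebra maps $\mathfrak s$ isomorphically onto it, and that the infinite-dimensional ideal $\mathfrak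 n$ is the set of elements mapped into the current algebra. -/

import Mathlib

open scoped ContDiff

noncomputable section

namespace DaveyStewartson

/-! ### Smooth functions of time -/

/-- The algebra `C^∞(ℝ)` of smooth real functions of the time `t`. -/
def smoothFun : Subalgebra ℝ (ℝ → ℝ) where
  carrier := {f | ContDiff ℝ ∞ f}
  mul_mem' {f g} (hf : ContDiff ℝ ∞ f) (hg : ContDiff ℝ ∞ g) := hf.mul hg
  add_mem' {f g} (hf : ContDiff ℝ ∞ f) (hg : ContDiff ℝ ∞ g) := hf.add hg
  algebraMap_mem' c := (contDiff_const : ContDiff ℝ ∞ fun _ : ℝ => c)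

/-- The type of smooth real functions of the time `t`. -/
abbrev C : Type := smoothFun

theorem C.contDiff (f : C) : ContDiff ℝ ∞ (f : ℝ → ℝ) := f.2

theorem C.differentiable (f : C) : Differentiable ℝ (f : ℝ → ℝ) :=
  f.contDiff.differentiable (by simp)

/-- The time derivative `d/dt`, as a derivation of `C^∞(ℝ)`. -/
def D : Derivation ℝ C C where
  toFun f := ⟨deriv f.1, (contDiff_infty_iff_deriv.1 f.2).2⟩
  map_add' f g := by
    ext t
    exact deriv_add (f.differentiable t) (g.differentiable t)
  map_smul' c f := by
    ext t
    exact deriv_const_mul c (f.differentiable t)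
  map_one_eq_zero' := by
    ext t
    exact deriv_const t (1 : ℝ)
  leibniz' f g := by
    ext t
    have h := deriv_mul (f.differentiable t) (g.differentiable t)
    change deriv (f.1 * g.1) t = f.1 t * deriv g.1 t + g.1 t * deriv f.1 t
    rw [h]
    ring

/-! ### The Lie algebra of smooth vector fields on the space of variables -/

/-- The space of the independent variables `(t, x, y)` and the dependent variables `(u, v, φ)`:
for `z : J0`, `z.1 0, z.1 1, z.1 2` are `t, x, y` and `z.2 0, z.2 1, z.2 2` are `u, v, φ`. -/
abbrev J0 : Type := (Fin 3 → ℝ) × (Fin 3 → ℝ)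

/-- The smooth vector fields on the space of variables. -/
def smoothVF : Submodule ℝ (J0 → J0) where
  carrier := {V | ContDiff ℝ ∞ V}
  add_mem' {V W} (hV : ContDiff ℝ ∞ V) (hW : ContDiff ℝ ∞ W) := hV.add hW
  zero_mem' := (contDiff_const : ContDiff ℝ ∞ fun _ : J0 => (0 : J0))
  smul_mem' c V (hV : ContDiff ℝ ∞ V) := hV.const_smul c

/-- The type of smooth vector fields on the space of variables. -/
abbrev VF : Type := smoothVF

theorem VF.contDiff (V : VF) : ContDiff ℝ ∞ (V : J0 → J0) := V.2

theorem VF.differentiable (V : VF) : Differentiable ℝ (V : J0 → J0) :=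
  V.contDiff.differentiable (by simp)

/-- The commutator of vector fields. -/
instance : Bracket VF VF where
  bracket V W := ⟨VectorField.lieBracket ℝ V.1 W.1,
    show ContDiff ℝ ∞ _ from V.contDiff.lieBracket_vectorField W.contDiff le_rfl⟩

theorem bracket_apply (V W : VF) (z : J0) :
    (⁅V, W⁆ : VF).1 z = fderiv ℝ W.1 z (V.1 z) - fderiv ℝ V.1 z (W.1 z) := rfl

instance : LieRing VF where
  add_lie U V W := by
    ext1; funext z
    exact VectorField.lieBracket_add_left (U.differentiable z) (V.differentiable z)
  lie_add U V W := by
    ext1; funext z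
    exact VectorField.lieBracket_add_right (V.differentiable z) (W.differentiable z)
  lie_self U := by
    ext1
    exact VectorField.lieBracket_self
  leibniz_lie U V W := by
    ext1; funext z
    exact VectorField.leibniz_identity_lieBracket (n := ∞)
      (by rw [minSmoothness_of_isRCLikeNormedField]; exact WithTop.coe_le_coe.2 le_top)
      U.contDiff.contDiffAt V.contDiff.contDiffAt W.contDiff.contDiffAt

instance : LieAlgebra ℝ VF where
  lie_smul c U V := by
    ext1; funext z
    exact VectorField.lieBracket_const_smul_right (V.differentiable z)

/-! ### Jets, prolongation and infinitesimal symmetries -/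

/-- First-order jets: a point `z` of `J0` and the first derivatives, `p a i = ∂ᵢ wᵃ`, where
`w = (u, v, φ)` and `∂₀, ∂₁, ∂₂` are `∂_t, ∂_x, ∂_y`. -/
abbrev J1 : Type := J0 × (Fin 3 → Fin 3 → ℝ)

/-- Second-order jets: a first-order jet and the second derivatives `q a i k = ∂ᵢ ∂ₖ wᵃ`. The jets
of functions are those with `q a i k = q a k i`. -/
abbrev J2 : Type := J1 × (Fin 3 → Fin 3 → Fin 3 → ℝ)

/-- The total derivative `Dᵢ F` of a function `F` of the variables. -/
def totalD0 (F : J0 → ℝ) (i : Fin 3) : J1 → ℝ := fun j =>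
  fderiv ℝ F j.1 (Pi.single i 1, fun a => j.2 a i)

/-- The total derivative `Dᵢ G` of a function `G` of the variables and the first derivatives. -/
def totalD1 (G : J1 → ℝ) (i : Fin 3) : J2 → ℝ := fun j =>
  fderiv ℝ G j.1 ((Pi.single i 1, fun a => j.1.2 a i), fun a k => j.2 a k i)

/-- For `V = Σ ξᵏ ∂ₖ + Σ ηᵃ ∂_{wᵃ}`, the coefficient of `∂_{wᵃᵢ}` in the prolongation of `V`:
`Dᵢ ηᵃ - Σₖ (Dᵢ ξᵏ) wᵃₖ`. -/
def prol1 (V : J0 → J0) (a i : Fin 3) : J1 → ℝ := fun j =>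
  totalD0 (fun z => (V z).2 a) i j - ∑ k, totalD0 (fun z => (V z).1 k) i j * j.2 a k

/-- The coefficient of `∂_{wᵃᵢₗ}` in the prolongation of `V`: `Dₗ ηᵃᵢ - Σₖ (Dₗ ξᵏ) wᵃᵢₖ`, where
`ηᵃᵢ` is the coefficient of `∂_{wᵃᵢ}`. -/
def prol2 (V : J0 → J0) (a i l : Fin 3) : J2 → ℝ := fun j =>
  totalD1 (prol1 V a i) l j - ∑ k, totalD0 (fun z => (V z).1 k) l j.1 * j.2 a i k

/-- The second prolongation `pr⁽²⁾ V`, a vector field on the space of second-order jets. -/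
def prolongation (V : J0 → J0) : J2 → J2 := fun j =>
  ((V j.1.1, fun a i => prol1 V a i j.1), fun a i l => prol2 V a i l j)

/-- The left-hand sides (minus the right-hand sides) of the Davey–Stewartson system
`i ψ_t + ψ_xx + ε₁ ψ_yy = ε₂ |ψ|² ψ + ψ φ_y`, `φ_xx + δ₁ φ_yy = δ₂ (|ψ|²)_y` with `ψ = u + i v`,
as functions on second-order jets: the real and the imaginary part of the first equation, and the
second equation, in which `(|ψ|²)_y = 2 (u u_y + v v_y)`. -/
def system (ε₁ ε₂ δ₁ δ₂ : ℝ) (j : J2) : Fin 3 → ℝ :=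
  let w := j.1.1.2
  let p := j.1.2
  let q := j.2
  let ψ : ℂ := ⟨w 0, w 1⟩
  let ψt : ℂ := ⟨p 0 0, p 1 0⟩
  let ψxx : ℂ := ⟨q 0 1 1, q 1 1 1⟩
  let ψyy : ℂ := ⟨q 0 2 2, q 1 2 2⟩
  let e : ℂ := Complex.I * ψt + ψxx + ε₁ * ψyy
    - (ε₂ * (Complex.normSq ψ : ℂ) * ψ + ψ * (p 2 2 : ℂ))
  ![e.re, e.im, q 2 1 1 + δ₁ * q 2 2 2 - δ₂ * (2 * (w 0 * p 0 2 + w 1 * p 1 2))]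

/-- `V` is an infinitesimal Lie point symmetry of the Davey–Stewartson system: its second
prolongation annihilates the system at all second-order jets that satisfy the system. -/
def IsSymmetry (ε₁ ε₂ δ₁ δ₂ : ℝ) (V : VF) : Prop :=
  ∀ j : J2, (∀ a i k, j.2 a i k = j.2 a k i) → system ε₁ ε₂ δ₁ δ₂ j = 0 →
    fderiv ℝ (system ε₁ ε₂ δ₁ δ₂) j (prolongation V.1 j) = 0

/-! ### The generators

A vector field is given by the list `(τ, ξ, η; U, V, Φ)` of its coefficients at
`∂_t, ∂_x, ∂_y; ∂_u, ∂_v, ∂_φ`. -/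

theorem contDiff_mk {a b c d e f : J0 → ℝ} (ha : ContDiff ℝ ∞ a) (hb : ContDiff ℝ ∞ b)
    (hc : ContDiff ℝ ∞ c) (hd : ContDiff ℝ ∞ d) (he : ContDiff ℝ ∞ e) (hf : ContDiff ℝ ∞ f) :
    ContDiff ℝ ∞ (fun z : J0 => ((![a z, b z, c z], ![d z, e z, f z]) : J0)) := by
  refine ContDiff.prodMk ?_ ?_
  · refine contDiff_pi.2 fun i => ?_
    fin_cases i
    exacts [ha, hb, hc]
  · refine contDiff_pi.2 fun i => ?_
    fin_cases i
    exacts [hd, he, hf]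

/-- `X(τ) = τ ∂_t + (τ'/2)(x ∂_x + y ∂_y - u ∂_u - v ∂_v - φ ∂_φ)
  - ((x² + ε₁ y²)/8) τ'' (v ∂_u - u ∂_v) - (τ'''/8)(x² y + (ε₁/3) y³) ∂_φ`. -/
def X (ε₁ : ℝ) (τ : C) : VF :=
  ⟨fun z =>
    let t := z.1 0; let x := z.1 1; let y := z.1 2
    let u := z.2 0; let v := z.2 1; let φ := z.2 2
    (![τ.1 t, (D τ).1 t / 2 * x, (D τ).1 t / 2 * y],
     ![-((D τ).1 t / 2 * u) - (x ^ 2 + ε₁ * y ^ 2) / 8 * (D (D τ)).1 t * v,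
       -((D τ).1 t / 2 * v) + (x ^ 2 + ε₁ * y ^ 2) / 8 * (D (D τ)).1 t * u,
       -((D τ).1 t / 2 * φ) - (D (D (D τ))).1 t / 8 * (x ^ 2 * y + ε₁ / 3 * y ^ 3)]), by
    obtain ⟨f3, h3 : ContDiff ℝ ∞ f3⟩ := D (D (D τ))
    obtain ⟨f2, h2 : ContDiff ℝ ∞ f2⟩ := D (D τ)
    obtain ⟨f1, h1 : ContDiff ℝ ∞ f1⟩ := D τ
    obtain ⟨f0, h0 : ContDiff ℝ ∞ f0⟩ := τ
    dsimp only
    exact contDiff_mk (by fun_prop) (by fun_prop) (by fun_prop) (by fun_prop) (by fun_prop)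
      (by fun_prop)⟩

/-- `Y(α) = α ∂_x - (x/2) α' (v ∂_u - u ∂_v) - (x y/2) α'' ∂_φ`. -/
def Y (α : C) : VF :=
  ⟨fun z =>
    let t := z.1 0; let x := z.1 1; let y := z.1 2
    let u := z.2 0; let v := z.2 1
    (![0, α.1 t, 0],
     ![-(x / 2 * (D α).1 t * v), x / 2 * (D α).1 t * u, -(x * y / 2 * (D (D α)).1 t)]), by
    obtain ⟨f2, h2 : ContDiff ℝ ∞ f2⟩ := D (D α)
    obtain ⟨f1, h1 : ContDiff ℝ ∞ f1⟩ := D α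
    obtain ⟨f0, h0 : ContDiff ℝ ∞ f0⟩ := α
    dsimp only
    exact contDiff_mk (by fun_prop) (by fun_prop) (by fun_prop) (by fun_prop) (by fun_prop)
      (by fun_prop)⟩

/-- `Z(β) = β ∂_y - (y/(2 ε₁)) β' (v ∂_u - u ∂_v) + (β''/(4 ε₁))(δ₁ x² - y²) ∂_φ`. -/
def Z (ε₁ δ₁ : ℝ) (β : C) : VF :=
  ⟨fun z =>
    let t := z.1 0; let x := z.1 1; let y := z.1 2
    let u := z.2 0; let v := z.2 1
    (![0, 0, β.1 t],
     ![-(y / (2 * ε₁) * (D β).1 t * v), y / (2 * ε₁) * (D β).1 t * u,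
       (D (D β)).1 t / (4 * ε₁) * (δ₁ * x ^ 2 - y ^ 2)]), by
    obtain ⟨f2, h2 : ContDiff ℝ ∞ f2⟩ := D (D β)
    obtain ⟨f1, h1 : ContDiff ℝ ∞ f1⟩ := D β
    obtain ⟨f0, h0 : ContDiff ℝ ∞ f0⟩ := β
    dsimp only
    exact contDiff_mk (by fun_prop) (by fun_prop) (by fun_prop) (by fun_prop) (by fun_prop)
      (by fun_prop)⟩

/-- `W(μ) = μ (v ∂_u - u ∂_v) + y μ' ∂_φ`. -/
def W (μ : C) : VF :=
  ⟨fun z =>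
    let t := z.1 0; let y := z.1 2
    let u := z.2 0; let v := z.2 1
    (![0, 0, 0], ![μ.1 t * v, -(μ.1 t * u), y * (D μ).1 t]), by
    obtain ⟨f1, h1 : ContDiff ℝ ∞ f1⟩ := D μ
    obtain ⟨f0, h0 : ContDiff ℝ ∞ f0⟩ := μ
    dsimp only
    exact contDiff_mk (by fun_prop) (by fun_prop) (by fun_prop) (by fun_prop) (by fun_prop)
      (by fun_prop)⟩

/-- `R(γ) = x γ ∂_φ`. -/
def R (γ : C) : VF :=
  ⟨fun z => (![0, 0, 0], ![0, 0, z.1 1 * γ.1 (z.1 0)]), by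
    obtain ⟨f0, h0 : ContDiff ℝ ∞ f0⟩ := γ
    dsimp only
    exact contDiff_mk (by fun_prop) (by fun_prop) (by fun_prop) (by fun_prop) (by fun_prop)
      (by fun_prop)⟩

/-- `S(δ) = δ ∂_φ`. -/
def S (δ : C) : VF :=
  ⟨fun z => (![0, 0, 0], ![0, 0, δ.1 (z.1 0)]), by
    obtain ⟨f0, h0 : ContDiff ℝ ∞ f0⟩ := δ
    dsimp only
    exact contDiff_mk (by fun_prop) (by fun_prop) (by fun_prop) (by fun_prop) (by fun_prop)
      (by fun_prop)⟩

/-! ### Centreless Kac–Moody–Virasoro algebras -/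

/-- The centreless Virasoro algebra over `C^∞(ℝ)`: the smooth vector fields `τ(t) d/dt` on the line,
with `[τ₁, τ₂] = τ₁ τ₂' - τ₁' τ₂`. -/
def Vir : Type := C

instance : AddCommGroup Vir := inferInstanceAs (AddCommGroup C)

instance : Module ℝ Vir := inferInstanceAs (Module ℝ C)

/-- The vector field `τ(t) d/dt` with the coefficient `τ`. -/
def Vir.of : C ≃ₗ[ℝ] Vir := LinearEquiv.refl ℝ C

/-- The coefficient of a vector field on the line. -/
def Vir.coeff : Vir ≃ₗ[ℝ] C := LinearEquiv.refl ℝ C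

instance : Bracket Vir Vir where
  bracket a b := Vir.of (a.coeff * D b.coeff - D a.coeff * b.coeff)

theorem Vir.coeff_lie (a b : Vir) :
    Vir.coeff ⁅a, b⁆ = a.coeff * D b.coeff - D a.coeff * b.coeff := rfl

instance : LieRing Vir where
  add_lie a b c := by
    apply Vir.coeff.injective
    simp only [Vir.coeff_lie, map_add]
    ring
  lie_add a b c := by
    apply Vir.coeff.injective
    simp only [Vir.coeff_lie, map_add]
    ring
  lie_self a := by
    apply Vir.coeff.injective
    simp only [Vir.coeff_lie, map_zero]
    ring
  leibniz_lie a b c := by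
    apply Vir.coeff.injective
    simp only [Vir.coeff_lie, map_add, map_sub, Derivation.leibniz, smul_eq_mul]
    ring

instance : LieAlgebra ℝ Vir where
  lie_smul c a b := by
    apply Vir.coeff.injective
    rw [Vir.coeff_lie, map_smul Vir.coeff, map_smul Vir.coeff, Vir.coeff_lie, D.map_smul,
      Algebra.mul_smul_comm, Algebra.mul_smul_comm, smul_sub]

attribute [local instance 100] LieRing.ofAssociativeRing LieAlgebra.ofAssociativeAlgebra

/-- The centreless Kac–Moody (current) algebra `sl(n, ℝ) ⊗ C^∞(ℝ)`: the trace-free matrices of smooth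
functions of `t`, with the pointwise commutator. -/
def Current (n : ℕ) : LieSubalgebra ℝ (Matrix (Fin n) (Fin n) C) where
  carrier := {A | A.trace = 0}
  add_mem' {A B} (hA : A.trace = 0) (hB : B.trace = 0) := by
    change (A + B).trace = 0
    rw [Matrix.trace_add, hA, hB, add_zero]
  zero_mem' := Matrix.trace_zero _ _
  smul_mem' c A (hA : A.trace = 0) := by
    change (c • A).trace = 0
    rw [Matrix.trace_smul, hA, smul_zero]
  lie_mem' {A B} _ _ := by
    change (A * B - B * A).trace = 0
    rw [Matrix.trace_sub, Matrix.trace_mul_comm, sub_self]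

instance (n : ℕ) : LieRing (Current n) := inferInstance

instance (n : ℕ) : LieAlgebra ℝ (Current n) := inferInstance

instance (n : ℕ) : AddCommGroup (Current n) := LieRing.toAddCommGroup

instance (n : ℕ) : AddCommSemigroup (Current n) := inferInstance

/-- The action `A ↦ τ A'` of a vector field `τ d/dt` on the line on the current algebra. -/
def Vir.act (n : ℕ) : Vir →ₗ⁅ℝ⁆ LieDerivation ℝ (Current n) (Current n) where
  toFun a :=
    { toFun := fun A => ⟨A.1.map fun f => a.coeff * D f, by
        have h : A.1.trace = 0 := A.2
        change Matrix.trace _ = 0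
        simp only [Matrix.trace, Matrix.diag_apply, Matrix.map_apply] at h ⊢
        rw [← Finset.mul_sum, ← map_sum, h, map_zero, mul_zero]⟩
      map_add' := fun A B => by
        ext1; ext1 i k
        change a.coeff * D (A.1 i k + B.1 i k) = a.coeff * D (A.1 i k) + a.coeff * D (B.1 i k)
        rw [map_add, mul_add]
      map_smul' := fun c A => by
        ext1; ext1 i k
        change a.coeff * D (c • A.1 i k) = c • (a.coeff * D (A.1 i k))
        rw [D.map_smul, Algebra.mul_smul_comm]
      leibniz' := fun A B => by
        ext1; ext1 i k
        change a.coeff * D ((A.1 * B.1 - B.1 * A.1) i k)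
          = (A.1 * (B.1.map fun f => a.coeff * D f) - (B.1.map fun f => a.coeff * D f) * A.1) i k
          - (B.1 * (A.1.map fun f => a.coeff * D f) - (A.1.map fun f => a.coeff * D f) * B.1) i k
        simp only [Matrix.sub_apply, Matrix.mul_apply, Matrix.map_apply, map_sub, map_sum,
          Derivation.leibniz, smul_eq_mul, Finset.sum_add_distrib, mul_sub, mul_add,
          Finset.mul_sum]
        simp only [← Finset.sum_sub_distrib, ← Finset.sum_add_distrib]
        exact Finset.sum_congr rfl fun l _ => by ring }
  map_add' a b := by
    ext A i k : 3
    change (a + b).coeff * D (A.1 i k) = a.coeff * D (A.1 i k) + b.coeff * D (A.1 i k)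
    rw [map_add, add_mul]
  map_smul' c a := by
    ext A i k : 3
    change (c • a).coeff * D (A.1 i k) = c • (a.coeff * D (A.1 i k))
    rw [map_smul, Algebra.smul_mul_assoc]
  map_lie' {a b} := by
    ext A i k : 3
    change (Vir.coeff ⁅a, b⁆) * D (A.1 i k)
      = a.coeff * D (b.coeff * D (A.1 i k)) - b.coeff * D (a.coeff * D (A.1 i k))
    rw [Vir.coeff_lie]
    simp only [Derivation.leibniz, smul_eq_mul]
    ring

/-- The centreless Kac–Moody–Virasoro algebra of `sl(n)`: the semidirect sum of the vector fields on
the line and the current algebra of `sl(n)`. -/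
abbrev KMV (n : ℕ) : Type := LieAlgebra.SemiDirectSum (Current n) Vir (Vir.act n)

/-- The Lie algebra `L` has a (centreless) Kac–Moody–Virasoro structure with Virasoro part `𝔰` and
Kac–Moody part `𝔫`: it embeds, for some `n`, into the Kac–Moody–Virasoro algebra of `sl(n)` in such a
way that `𝔰` is mapped isomorphically onto the Virasoro algebra by the projection to it, and that
`𝔫`, which is infinite-dimensional, consists of the elements mapped into the current algebra. -/
def IsKacMoodyVirasoro {L : Type} [LieRing L] [LieAlgebra ℝ L]
    (𝔰 : LieSubalgebra ℝ L) (𝔫 : LieIdeal ℝ L) : Prop :=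
  ∃ (n : ℕ) (f : L →ₗ⁅ℝ⁆ KMV n), Function.Injective f ∧
    Function.Bijective (fun s : 𝔰 => (f s).right) ∧
    (∀ v : L, v ∈ 𝔫 ↔ (f v).right = 0) ∧
    ¬ FiniteDimensional ℝ 𝔫

/-- `L = 𝔰 ⋉ 𝔫` is a Levi decomposition: `𝔫` is a solvable ideal which is the radical of `L`, `𝔰` is a
subalgebra without nonzero solvable ideals, and `L` is the direct sum of `𝔰` and `𝔫` as a
vector space. -/
structure IsLeviDecomposition {L : Type} [LieRing L] [LieAlgebra ℝ L]
    (𝔰 : LieSubalgebra ℝ L) (𝔫 : LieIdeal ℝ L) : Prop where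
  solvable : LieAlgebra.IsSolvable 𝔫
  radical_eq : LieAlgebra.radical ℝ L = 𝔫
  semisimple : LieAlgebra.HasTrivialRadical ℝ 𝔰
  isCompl : IsCompl 𝔰.toSubmodule 𝔫.toSubmodule

end DaveyStewartson

end

open scoped ContDiff

noncomputable section

namespace DaveyStewartson

/-! ### Pointwise calculus -/

/-! All six families are handled at once through the general element `G`, whose coefficients are
explicit in two functions: `phase`, the infinitesimal rotation of `ψ`, and `shift`, the
inhomogeneous part of the `∂_φ`-coefficient. One formula for its derivative, `fderiv_G`, gives both
the commutators (`lie_G`, from which every bracket of generators is a specialization) and the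
first-order terms of the prolongation.

That `G` is a symmetry (`isSymmetry_G`) is a direct check: the prolonged field sends each equation
to a combination of the equations, with multiplier `-(3/2) τ'` from the scaling and `± phase` from
the rotation of `ψ`. The only residue is a multiple of `y (ε₁ + δ₁) τ'''` in the equation for `φ`.

Conversely, the system is solved for the `xx`-derivatives, so the other second derivatives and all
first derivatives are free. The invariance condition is then a polynomial identity in free jet
coordinates, and its coefficients, extracted by evaluation at a few special jets, are the
determining equations (`pd_eta_first`, `pd_eta_second`). Integrating them (`exists_xi`,
`exists_eta`, `exists_G_of_isSymmetry`) gives in turn the `∂_t, ∂_x, ∂_y`-coefficients, linear `∂_u,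
∂_v`-coefficients, and the `∂_φ`-coefficient. The term `ψ φ_y` excludes rotations in the `x,
y`-plane, and the cubic term, through `ε₂ ≠ 0`, ties the scaling of `ψ` to `τ'`. The equation for
`φ` forces `(ε₁ + δ₁) τ''' = 0`.

If `δ₁ = -ε₁`, the map to `τ` is a surjection onto the vector fields on the line, an algebra with
trivial radical. Its kernel is solvable because its brackets fall into the abelian ideal of the `W,
R, S`. So the kernel is the radical, and `{X(τ)}` is a complement. For the embedding, `G` acts as `τ
d/dt + A` on a free `C^∞(ℝ)`-module of rank 8 spanned by functions of `x, y, φ` and the argument of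
`ψ`. Subtracting `(τ'/2)` times the identity makes `A` trace-free without disturbing the
commutators, because `τ ↦ τ'` is a cocycle (`currentMatrix_lieCoeffs`). -/

@[simp] theorem C.add_apply (f g : C) (t : ℝ) : (f + g).1 t = f.1 t + g.1 t := rfl
@[simp] theorem C.sub_apply (f g : C) (t : ℝ) : (f - g).1 t = f.1 t - g.1 t := rfl
@[simp] theorem C.mul_apply (f g : C) (t : ℝ) : (f * g).1 t = f.1 t * g.1 t := rfl
@[simp] theorem C.smul_apply (c : ℝ) (f : C) (t : ℝ) : (c • f).1 t = c * f.1 t := rfl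
@[simp] theorem C.zero_apply (t : ℝ) : (0 : C).1 t = 0 := rfl

@[ext] theorem C.ext {f g : C} (h : ∀ t, f.1 t = g.1 t) : f = g := Subtype.ext (funext h)

theorem D_mul (f g : C) : D (f * g) = f * D g + D f * g := by
  rw [Derivation.leibniz, smul_eq_mul, smul_eq_mul, mul_comm g]

theorem C.hasDerivAt (f : C) (t : ℝ) : HasDerivAt f.1 ((D f).1 t) t :=
  (f.differentiable t).hasDerivAt

theorem C.hasDerivAt_line (f : C) (t a : ℝ) :
    HasDerivAt (fun s : ℝ => f.1 (t + s * a)) ((D f).1 t * a) 0 := by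
  have h : HasDerivAt (fun s : ℝ => t + s * a) a 0 := by
    simpa using ((hasDerivAt_id (0 : ℝ)).mul_const a).const_add t
  have := HasDerivAt.comp (0 : ℝ) (h₂ := f.1) (h₂' := (D f).1 t) (by simpa using f.hasDerivAt t) h
  exact this

theorem hasDerivAt_line (x a : ℝ) : HasDerivAt (fun s : ℝ => x + s * a) a 0 := by
  simpa using ((hasDerivAt_id (0 : ℝ)).mul_const a).const_add x

/-- The derivative in the direction `v`, computed along the line through `z`. -/
theorem fderiv_apply_of_line {E F : Type*} [NormedAddCommGroup E] [NormedSpace ℝ E]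
    [NormedAddCommGroup F] [NormedSpace ℝ F] {f : E → F} {z v : E} {f' : F}
    (hf : DifferentiableAt ℝ f z) (h : HasDerivAt (fun s : ℝ => f (z + s • v)) f' 0) :
    fderiv ℝ f z v = f' := by
  rw [← hf.lineDeriv_eq_fderiv]
  exact h.deriv

/-! ### The general element -/

/-- The sum `X(τ) + Y(α) + Z(β) + W(μ) + R(γ) + S(δ)`. -/
def G (ε₁ δ₁ : ℝ) (τ α β μ γ δ : C) : VF :=
  X ε₁ τ + Y α + Z ε₁ δ₁ β + W μ + R γ + S δ

/-- The coefficient of `v ∂_u - u ∂_v` in the general element. -/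
def phase (ε₁ : ℝ) (τ α β μ : C) (t x y : ℝ) : ℝ :=
  μ.1 t - (x ^ 2 + ε₁ * y ^ 2) / 8 * (D (D τ)).1 t - x / 2 * (D α).1 t
    - y / 2 * (ε₁ * (D β).1 t)

/-- The coefficient of `∂_φ` in the general element, at `φ = 0`. -/
def shift (ε₁ δ₁ : ℝ) (τ α β μ γ δ : C) (t x y : ℝ) : ℝ :=
  -((D (D (D τ))).1 t / 8 * (x ^ 2 * y + ε₁ / 3 * y ^ 3)) - x * y / 2 * (D (D α)).1 t
    + ε₁ * (D (D β)).1 t / 4 * (δ₁ * x ^ 2 - y ^ 2) + y * (D μ).1 t + x * γ.1 t + δ.1 t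

/-- Since `ε₁² = 1`, the factors `1 / ε₁` in `Z` become `ε₁`; the coefficients are then polynomial
in `ε₁`, which suits `ring`. -/
theorem G_apply {ε₁ : ℝ} (hε₁ : ε₁ = 1 ∨ ε₁ = -1) (δ₁ : ℝ) (τ α β μ γ δ : C) (z : J0) :
    (G ε₁ δ₁ τ α β μ γ δ).1 z =
      (![τ.1 (z.1 0), (D τ).1 (z.1 0) / 2 * z.1 1 + α.1 (z.1 0),
          (D τ).1 (z.1 0) / 2 * z.1 2 + β.1 (z.1 0)],
        ![-((D τ).1 (z.1 0) / 2 * z.2 0) + phase ε₁ τ α β μ (z.1 0) (z.1 1) (z.1 2) * z.2 1,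
          -((D τ).1 (z.1 0) / 2 * z.2 1) - phase ε₁ τ α β μ (z.1 0) (z.1 1) (z.1 2) * z.2 0,
          -((D τ).1 (z.1 0) / 2 * z.2 2)
            + shift ε₁ δ₁ τ α β μ γ δ (z.1 0) (z.1 1) (z.1 2)]) := by
  have hi : ∀ a : ℝ, a / (2 * ε₁) = ε₁ * a / 2 := by
    intro a; rcases hε₁ with rfl | rfl <;> ring
  have hi' : ∀ a : ℝ, a / (4 * ε₁) = ε₁ * a / 4 := by
    intro a; rcases hε₁ with rfl | rfl <;> ring
  have e : (G ε₁ δ₁ τ α β μ γ δ).1 z = (X ε₁ τ).1 z + (Y α).1 z + (Z ε₁ δ₁ β).1 z + (W μ).1 z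
    + (R γ).1 z + (S δ).1 z := rfl
  rw [e]
  ext i <;> fin_cases i <;>
    simp [X, Y, Z, W, R, S, phase, shift, hi, hi'] <;> ring

theorem hasDerivAt_mk {a b c d e f : ℝ → ℝ} {a' b' c' d' e' f' s : ℝ} (ha : HasDerivAt a a' s)
    (hb : HasDerivAt b b' s) (hc : HasDerivAt c c' s) (hd : HasDerivAt d d' s)
    (he : HasDerivAt e e' s) (hf : HasDerivAt f f' s) :
    HasDerivAt (fun r => ((![a r, b r, c r], ![d r, e r, f r]) : J0))
      (![a', b', c'], ![d', e', f']) s := by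
  refine HasDerivAt.prodMk ?_ ?_
  · refine hasDerivAt_pi.2 fun i => ?_
    fin_cases i
    exacts [ha, hb, hc]
  · refine hasDerivAt_pi.2 fun i => ?_
    fin_cases i
    exacts [hd, he, hf]

/-- `phase` is linear in the four functions with coefficients free of `t`, so its `t`-derivative is
`phase` of the differentiated functions; the remaining terms come from `x` and `y`. The same holds
for `shift`. -/
theorem hasDerivAt_phase (ε₁ : ℝ) (τ α β μ : C) (t x y a b c : ℝ) :
    HasDerivAt (fun s : ℝ => phase ε₁ τ α β μ (t + s * a) (x + s * b) (y + s * c))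
      (phase ε₁ (D τ) (D α) (D β) (D μ) t x y * a
        - ((x * b + ε₁ * y * c) / 4 * (D (D τ)).1 t + b / 2 * (D α).1 t
          + c / 2 * (ε₁ * (D β).1 t))) 0 := by
  have hx := hasDerivAt_line x b
  have hy := hasDerivAt_line y c
  have h := ((((μ.hasDerivAt_line t a).sub
    ((((hx.pow 2).add ((hy.pow 2).const_mul ε₁)).div_const 8).mul
      ((D (D τ)).hasDerivAt_line t a))).sub
    ((hx.div_const 2).mul ((D α).hasDerivAt_line t a))).sub
    ((hy.div_const 2).mul (((D β).hasDerivAt_line t a).const_mul ε₁)))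
  refine h.congr_deriv ?_
  simp [phase]
  ring

theorem hasDerivAt_shift (ε₁ δ₁ : ℝ) (τ α β μ γ δ : C) (t x y a b c : ℝ) :
    HasDerivAt (fun s : ℝ => shift ε₁ δ₁ τ α β μ γ δ (t + s * a) (x + s * b) (y + s * c))
      (shift ε₁ δ₁ (D τ) (D α) (D β) (D μ) (D γ) (D δ) t x y * a
        - (D (D (D τ))).1 t / 8 * (2 * x * y * b + (x ^ 2 + ε₁ * y ^ 2) * c)
        - (x * c + y * b) / 2 * (D (D α)).1 t
        + ε₁ * (D (D β)).1 t / 2 * (δ₁ * x * b - y * c) + c * (D μ).1 t + b * γ.1 t) 0 := by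
  have hx := hasDerivAt_line x b
  have hy := hasDerivAt_line y c
  have h := ((((((((D (D (D τ))).hasDerivAt_line t a).div_const 8).mul
      (((hx.pow 2).mul hy).add ((hy.pow 3).const_mul (ε₁ / 3)))).neg.sub
    (((hx.mul hy).div_const 2).mul ((D (D α)).hasDerivAt_line t a))).add
    (((((D (D β)).hasDerivAt_line t a).const_mul ε₁).div_const 4).mul
      (((hx.pow 2).const_mul δ₁).sub (hy.pow 2)))).add
    (hy.mul ((D μ).hasDerivAt_line t a))).add (hx.mul (γ.hasDerivAt_line t a))).add
    (δ.hasDerivAt_line t a)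
  refine h.congr_deriv ?_
  simp [shift]
  ring

theorem fderiv_G {ε₁ : ℝ} (hε₁ : ε₁ = 1 ∨ ε₁ = -1) (δ₁ : ℝ) (τ α β μ γ δ : C) (z v : J0) :
    fderiv ℝ (G ε₁ δ₁ τ α β μ γ δ).1 z v =
      (![(D τ).1 (z.1 0) * v.1 0,
          (D (D τ)).1 (z.1 0) / 2 * v.1 0 * z.1 1 + (D τ).1 (z.1 0) / 2 * v.1 1
            + (D α).1 (z.1 0) * v.1 0,
          (D (D τ)).1 (z.1 0) / 2 * v.1 0 * z.1 2 + (D τ).1 (z.1 0) / 2 * v.1 2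
            + (D β).1 (z.1 0) * v.1 0],
        ![-((D (D τ)).1 (z.1 0) / 2 * v.1 0 * z.2 0 + (D τ).1 (z.1 0) / 2 * v.2 0)
            + (phase ε₁ (D τ) (D α) (D β) (D μ) (z.1 0) (z.1 1) (z.1 2) * v.1 0
              - ((z.1 1 * v.1 1 + ε₁ * z.1 2 * v.1 2) / 4 * (D (D τ)).1 (z.1 0)
                + v.1 1 / 2 * (D α).1 (z.1 0) + v.1 2 / 2 * (ε₁ * (D β).1 (z.1 0)))) * z.2 1
            + phase ε₁ τ α β μ (z.1 0) (z.1 1) (z.1 2) * v.2 1,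
          -((D (D τ)).1 (z.1 0) / 2 * v.1 0 * z.2 1 + (D τ).1 (z.1 0) / 2 * v.2 1)
            - ((phase ε₁ (D τ) (D α) (D β) (D μ) (z.1 0) (z.1 1) (z.1 2) * v.1 0
              - ((z.1 1 * v.1 1 + ε₁ * z.1 2 * v.1 2) / 4 * (D (D τ)).1 (z.1 0)
                + v.1 1 / 2 * (D α).1 (z.1 0) + v.1 2 / 2 * (ε₁ * (D β).1 (z.1 0)))) * z.2 0
            + phase ε₁ τ α β μ (z.1 0) (z.1 1) (z.1 2) * v.2 0),
          -((D (D τ)).1 (z.1 0) / 2 * v.1 0 * z.2 2 + (D τ).1 (z.1 0) / 2 * v.2 2)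
            + (shift ε₁ δ₁ (D τ) (D α) (D β) (D μ) (D γ) (D δ) (z.1 0) (z.1 1) (z.1 2) * v.1 0
              - (D (D (D τ))).1 (z.1 0) / 8
                * (2 * z.1 1 * z.1 2 * v.1 1 + (z.1 1 ^ 2 + ε₁ * z.1 2 ^ 2) * v.1 2)
              - (z.1 1 * v.1 2 + z.1 2 * v.1 1) / 2 * (D (D α)).1 (z.1 0)
              + ε₁ * (D (D β)).1 (z.1 0) / 2 * (δ₁ * z.1 1 * v.1 1 - z.1 2 * v.1 2)
              + v.1 2 * (D μ).1 (z.1 0) + v.1 1 * γ.1 (z.1 0))]) := by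
  refine fderiv_apply_of_line ((G ε₁ δ₁ τ α β μ γ δ).differentiable z) ?_
  have hp := hasDerivAt_phase ε₁ τ α β μ (z.1 0) (z.1 1) (z.1 2) (v.1 0) (v.1 1) (v.1 2)
  have hs := hasDerivAt_shift ε₁ δ₁ τ α β μ γ δ (z.1 0) (z.1 1) (z.1 2) (v.1 0) (v.1 1) (v.1 2)
  have h1 := (((D τ).hasDerivAt_line (z.1 0) (v.1 0)).div_const 2)
  have l := fun i => hasDerivAt_line (z.1 i) (v.1 i)
  have m := fun i => hasDerivAt_line (z.2 i) (v.2 i)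
  have key := hasDerivAt_mk (τ.hasDerivAt_line (z.1 0) (v.1 0))
    ((h1.mul (l 1)).add (α.hasDerivAt_line (z.1 0) (v.1 0)))
    ((h1.mul (l 2)).add (β.hasDerivAt_line (z.1 0) (v.1 0)))
    ((h1.mul (m 0)).neg.add (hp.mul (m 1)))
    ((h1.mul (m 1)).neg.sub (hp.mul (m 0)))
    ((h1.mul (m 2)).neg.add hs)
  refine (key.congr_deriv ?_).congr_of_eventuallyEq (.of_forall fun s => ?_)
  · simp only [zero_mul, add_zero]
    ext i <;> fin_cases i <;> dsimp <;> ring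
  · exact G_apply hε₁ δ₁ τ α β μ γ δ (z + s • v)

/-! ### Commutators -/

/-- Every component is an identity in the values of the functions and their derivatives. The
restriction on `τ` enters only through `[X, Z]`, whose `∂_φ`-coefficient differs from the expected
one by a multiple of `x² (ε₁ + δ₁) τ''' β`. -/
theorem lie_G {ε₁ δ₁ : ℝ} (hε₁ : ε₁ = 1 ∨ ε₁ = -1) {τ τ' : C} (α β μ γ δ α' β' μ' γ' δ' : C)
    (hτ : (ε₁ + δ₁) • D (D (D τ)) = 0) (hτ' : (ε₁ + δ₁) • D (D (D τ')) = 0) :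
    ⁅G ε₁ δ₁ τ α β μ γ δ, G ε₁ δ₁ τ' α' β' μ' γ' δ'⁆ =
      G ε₁ δ₁ (τ * D τ' - D τ * τ')
        (τ * D α' - (1 / 2 : ℝ) • (D τ * α') - (τ' * D α - (1 / 2 : ℝ) • (D τ' * α)))
        (τ * D β' - (1 / 2 : ℝ) • (D τ * β') - (τ' * D β - (1 / 2 : ℝ) • (D τ' * β)))
        (τ * D μ' - τ' * D μ - (1 / 2 : ℝ) • (α * D α' - D α * α')
          - (ε₁ / 2) • (β * D β' - D β * β'))
        (τ * D γ' + D τ * γ' - (τ' * D γ + D τ' * γ)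
          + (1 / 2 : ℝ) • (D (D α) * β' + (δ₁ * ε₁) • (α * D (D β')))
          - (1 / 2 : ℝ) • (D (D α') * β + (δ₁ * ε₁) • (α' * D (D β))))
        (τ * D δ' + (1 / 2 : ℝ) • (D τ * δ') - (τ' * D δ + (1 / 2 : ℝ) • (D τ' * δ))
          + α * γ' - α' * γ + β * D μ' - β' * D μ) := by
  ext1; funext z
  have h := congrArg (fun f : C => f.1 (z.1 0)) hτ
  have h' := congrArg (fun f : C => f.1 (z.1 0)) hτ'
  simp only [C.smul_apply, C.zero_apply] at h h'
  rw [bracket_apply, fderiv_G hε₁, fderiv_G hε₁, G_apply hε₁, G_apply hε₁, G_apply hε₁]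
  simp only [phase, shift, D_mul, map_add, map_sub, D.map_smul, C.add_apply, C.sub_apply,
    C.mul_apply, C.smul_apply]
  ext i <;> fin_cases i <;> dsimp
  · ring
  · ring
  · ring
  · ring
  · ring
  · rcases hε₁ with rfl | rfl
    · linear_combination (z.1 1 ^ 2 / 8) * (β'.1 (z.1 0) * h - β.1 (z.1 0) * h')
    · linear_combination -(z.1 1 ^ 2 / 8) * (β'.1 (z.1 0) * h - β.1 (z.1 0) * h')

/-! ### The generators as special general elements -/

section zero

theorem X_zero (ε₁ : ℝ) : X ε₁ 0 = 0 := by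
  ext1; funext z
  ext i <;> fin_cases i <;> simp [X]

theorem Y_zero : Y 0 = 0 := by
  ext1; funext z
  ext i <;> fin_cases i <;> simp [Y]

theorem Z_zero (ε₁ δ₁ : ℝ) : Z ε₁ δ₁ 0 = 0 := by
  ext1; funext z
  ext i <;> fin_cases i <;> simp [Z]

theorem W_zero : W 0 = 0 := by
  ext1; funext z
  ext i <;> fin_cases i <;> simp [W]

theorem R_zero : R 0 = 0 := by
  ext1; funext z
  ext i <;> fin_cases i <;> simp [R]

theorem S_zero : S 0 = 0 := by
  ext1; funext z
  ext i <;> fin_cases i <;> simp [S]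

end zero

theorem W_smul (c : ℝ) (μ : C) : W (c • μ) = c • W μ := by
  ext1; funext z
  ext i <;> fin_cases i <;> simp [W] <;> ring

theorem R_smul (c : ℝ) (γ : C) : R (c • γ) = c • R γ := by
  ext1; funext z
  ext i <;> fin_cases i <;> simp [R]; ring

theorem G_add {ε₁ : ℝ} (hε₁ : ε₁ = 1 ∨ ε₁ = -1) (δ₁ : ℝ)
    (τ α β μ γ δ τ' α' β' μ' γ' δ' : C) :
    G ε₁ δ₁ τ α β μ γ δ + G ε₁ δ₁ τ' α' β' μ' γ' δ' =
      G ε₁ δ₁ (τ + τ') (α + α') (β + β') (μ + μ') (γ + γ') (δ + δ') := by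
  ext1; funext z
  change (G ε₁ δ₁ τ α β μ γ δ).1 z + (G ε₁ δ₁ τ' α' β' μ' γ' δ').1 z = _
  rw [G_apply hε₁, G_apply hε₁, G_apply hε₁]
  simp only [phase, shift, map_add, C.add_apply]
  ext i <;> fin_cases i <;> dsimp <;> ring

theorem G_smul {ε₁ : ℝ} (hε₁ : ε₁ = 1 ∨ ε₁ = -1) (δ₁ c : ℝ) (τ α β μ γ δ : C) :
    c • G ε₁ δ₁ τ α β μ γ δ =
      G ε₁ δ₁ (c • τ) (c • α) (c • β) (c • μ) (c • γ) (c • δ) := by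
  ext1; funext z
  change c • (G ε₁ δ₁ τ α β μ γ δ).1 z = _
  rw [G_apply hε₁, G_apply hε₁]
  simp only [phase, shift, D.map_smul, C.smul_apply]
  ext i <;> fin_cases i <;> dsimp <;> ring

theorem G_zero (ε₁ δ₁ : ℝ) : G ε₁ δ₁ 0 0 0 0 0 0 = 0 := by
  simp [G, X_zero, Y_zero, Z_zero, W_zero, R_zero, S_zero]

section single

variable (ε₁ δ₁ : ℝ) (f : C)

theorem X_eq_G : X ε₁ f = G ε₁ δ₁ f 0 0 0 0 0 := by
  simp [G, Y_zero, Z_zero, W_zero, R_zero, S_zero]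

theorem Y_eq_G : Y f = G ε₁ δ₁ 0 f 0 0 0 0 := by
  simp [G, X_zero, Z_zero, W_zero, R_zero, S_zero]

theorem Z_eq_G : Z ε₁ δ₁ f = G ε₁ δ₁ 0 0 f 0 0 0 := by
  simp [G, X_zero, Y_zero, W_zero, R_zero, S_zero]

theorem W_eq_G : W f = G ε₁ δ₁ 0 0 0 f 0 0 := by
  simp [G, X_zero, Y_zero, Z_zero, R_zero, S_zero]

theorem R_eq_G : R f = G ε₁ δ₁ 0 0 0 0 f 0 := by
  simp [G, X_zero, Y_zero, Z_zero, W_zero, S_zero]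

theorem S_eq_G : S f = G ε₁ δ₁ 0 0 0 0 0 f := by
  simp [G, X_zero, Y_zero, Z_zero, W_zero, R_zero]

end single

/-! ### The commutation relations of the generators -/

theorem lie_X_X {ε₁ : ℝ} (hε₁ : ε₁ = 1 ∨ ε₁ = -1) (δ₁ : ℝ)
    {τ τ' : C} (hτ : (ε₁ + δ₁) • D (D (D τ)) = 0)
    (hτ' : (ε₁ + δ₁) • D (D (D τ')) = 0) :
    ⁅X ε₁ τ, X ε₁ τ'⁆ = X ε₁ (τ * D τ' - D τ * τ') := by
  simpa [← X_eq_G] using lie_G hε₁ 0 0 0 0 0 0 0 0 0 0 hτ hτ'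

theorem lie_X_Y {ε₁ : ℝ} (hε₁ : ε₁ = 1 ∨ ε₁ = -1) (δ₁ : ℝ)
    {τ : C} (hτ : (ε₁ + δ₁) • D (D (D τ)) = 0) (α : C) :
    ⁅X ε₁ τ, Y α⁆ = Y (τ * D α - (1 / 2 : ℝ) • (D τ * α)) := by
  simpa [← X_eq_G, ← Y_eq_G] using lie_G (τ' := 0) hε₁ 0 0 0 0 0 α 0 0 0 0 hτ (by simp)

theorem lie_X_Z {ε₁ : ℝ} (hε₁ : ε₁ = 1 ∨ ε₁ = -1) (δ₁ : ℝ)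
    {τ : C} (hτ : (ε₁ + δ₁) • D (D (D τ)) = 0) (β : C) :
    ⁅X ε₁ τ, Z ε₁ δ₁ β⁆ = Z ε₁ δ₁ (τ * D β - (1 / 2 : ℝ) • (D τ * β)) := by
  simpa [← X_eq_G, ← Z_eq_G] using lie_G (τ' := 0) hε₁ 0 0 0 0 0 0 β 0 0 0 hτ (by simp)

theorem lie_X_W {ε₁ : ℝ} (hε₁ : ε₁ = 1 ∨ ε₁ = -1) (δ₁ : ℝ)
    {τ : C} (hτ : (ε₁ + δ₁) • D (D (D τ)) = 0) (μ : C) :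
    ⁅X ε₁ τ, W μ⁆ = W (τ * D μ) := by
  simpa [← X_eq_G, ← W_eq_G] using lie_G (τ' := 0) hε₁ 0 0 0 0 0 0 0 μ 0 0 hτ (by simp)

theorem lie_X_R {ε₁ : ℝ} (hε₁ : ε₁ = 1 ∨ ε₁ = -1) (δ₁ : ℝ)
    {τ : C} (hτ : (ε₁ + δ₁) • D (D (D τ)) = 0) (γ : C) :
    ⁅X ε₁ τ, R γ⁆ = R (τ * D γ + D τ * γ) := by
  simpa [← X_eq_G, ← R_eq_G] using lie_G (τ' := 0) hε₁ 0 0 0 0 0 0 0 0 γ 0 hτ (by simp)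

theorem lie_X_S {ε₁ : ℝ} (hε₁ : ε₁ = 1 ∨ ε₁ = -1) (δ₁ : ℝ)
    {τ : C} (hτ : (ε₁ + δ₁) • D (D (D τ)) = 0) (δ : C) :
    ⁅X ε₁ τ, S δ⁆ = S (τ * D δ + (1 / 2 : ℝ) • (D τ * δ)) := by
  simpa [← X_eq_G, ← S_eq_G] using lie_G (τ' := 0) hε₁ 0 0 0 0 0 0 0 0 0 δ hτ (by simp)

theorem lie_G_G {ε₁ : ℝ} (hε₁ : ε₁ = 1 ∨ ε₁ = -1) (δ₁ : ℝ)
    (α β μ γ δ α' β' μ' γ' δ' : C) :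
    ⁅G ε₁ δ₁ 0 α β μ γ δ, G ε₁ δ₁ 0 α' β' μ' γ' δ'⁆ =
      G ε₁ δ₁ 0 0 0
        (-(1 / 2 : ℝ) • (α * D α' - D α * α') - (ε₁ / 2) • (β * D β' - D β * β'))
        ((1 / 2 : ℝ) • (D (D α) * β' + (δ₁ * ε₁) • (α * D (D β')))
          - (1 / 2 : ℝ) • (D (D α') * β + (δ₁ * ε₁) • (α' * D (D β))))
        (α * γ' - α' * γ + β * D μ' - β' * D μ) := by
  rw [lie_G hε₁ α β μ γ δ α' β' μ' γ' δ' (by simp) (by simp)]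
  simp

theorem lie_Y_Y {ε₁ : ℝ} (hε₁ : ε₁ = 1 ∨ ε₁ = -1)
    (α α' : C) :
    ⁅Y α, Y α'⁆ = -(1 / 2 : ℝ) • W (α * D α' - D α * α') := by
  rw [← W_smul]
  simpa [← Y_eq_G, ← W_eq_G] using lie_G_G hε₁ 0 α 0 0 0 0 α' 0 0 0 0

theorem lie_Z_Z {ε₁ : ℝ} (hε₁ : ε₁ = 1 ∨ ε₁ = -1) (δ₁ : ℝ)
    (β β' : C) :
    ⁅Z ε₁ δ₁ β, Z ε₁ δ₁ β'⁆ = -(ε₁ / 2) • W (β * D β' - D β * β') := by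
  rw [← W_smul, neg_smul]
  simpa [← Z_eq_G, ← W_eq_G] using lie_G_G hε₁ δ₁ 0 β 0 0 0 0 β' 0 0 0

theorem lie_Y_Z {ε₁ : ℝ} (hε₁ : ε₁ = 1 ∨ ε₁ = -1) (δ₁ : ℝ)
    (α β : C) :
    ⁅Y α, Z ε₁ δ₁ β⁆ = (1 / 2 : ℝ) • R (D (D α) * β + (δ₁ * ε₁) • (α * D (D β))) := by
  rw [← R_smul]
  simpa [← Y_eq_G, ← Z_eq_G, ← R_eq_G] using lie_G_G hε₁ δ₁ α 0 0 0 0 0 β 0 0 0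

theorem lie_Y_R {ε₁ : ℝ} (hε₁ : ε₁ = 1 ∨ ε₁ = -1)
    (α γ : C) : ⁅Y α, R γ⁆ = S (α * γ) := by
  simpa [← Y_eq_G, ← R_eq_G, ← S_eq_G] using lie_G_G hε₁ 0 α 0 0 0 0 0 0 0 γ 0

theorem lie_Z_W {ε₁ : ℝ} (hε₁ : ε₁ = 1 ∨ ε₁ = -1) (δ₁ : ℝ)
    (β μ : C) : ⁅Z ε₁ δ₁ β, W μ⁆ = S (β * D μ) := by
  simpa [← Z_eq_G, ← W_eq_G, ← S_eq_G] using lie_G_G hε₁ δ₁ 0 β 0 0 0 0 0 μ 0 0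

theorem lie_eq_zero {ε₁ : ℝ} (hε₁ : ε₁ = 1 ∨ ε₁ = -1) (δ₁ : ℝ)
    (f g : C) : ⁅Y f, W g⁆ = 0 ∧ ⁅Y f, S g⁆ = 0 ∧ ⁅Z ε₁ δ₁ f, R g⁆ = 0 ∧
    ⁅Z ε₁ δ₁ f, S g⁆ = 0 ∧ ⁅W f, W g⁆ = 0 ∧ ⁅W f, R g⁆ = 0 ∧ ⁅W f, S g⁆ = 0 ∧
    ⁅R f, R g⁆ = 0 ∧ ⁅R f, S g⁆ = 0 ∧ ⁅S f, S g⁆ = 0 := by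
  simp only [Y_eq_G ε₁ δ₁, Z_eq_G, W_eq_G ε₁ δ₁, R_eq_G ε₁ δ₁, S_eq_G ε₁ δ₁, lie_G_G hε₁]
  simp [G_zero]

/-- The functions are read off from values at points with `u = φ = 0`: `τ, α, β` and `δ` at the
spatial origin, `μ` from the `∂_u`-coefficient at `v = 1`, and `γ` at `x = 1` once `β` and `δ` are
known to agree. -/
theorem G_injective {ε₁ : ℝ} (hε₁ : ε₁ = 1 ∨ ε₁ = -1) (δ₁ : ℝ)
    {τ α β μ γ δ τ' α' β' μ' γ' δ' : C}
    (h : G ε₁ δ₁ τ α β μ γ δ = G ε₁ δ₁ τ' α' β' μ' γ' δ') :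
    τ = τ' ∧ α = α' ∧ β = β' ∧ μ = μ' ∧ γ = γ' ∧ δ = δ' := by
  have H : ∀ t x y v : ℝ, _ := fun t x y v =>
    ((G_apply hε₁ δ₁ τ α β μ γ δ (![t, x, y], ![0, v, 0])).symm.trans
      (congrArg (fun V : VF => V.1 (![t, x, y], ![0, v, 0])) h)).trans
      (G_apply hε₁ δ₁ τ' α' β' μ' γ' δ' (![t, x, y], ![0, v, 0]))
  simp only [Prod.ext_iff, funext_iff, Fin.forall_fin_succ, phase, shift] at H
  simp at H
  obtain rfl : τ = τ' := by
    ext t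
    exact (H t 0 0 0).1.1
  obtain rfl : α = α' := by
    ext t
    simpa using (H t 0 0 0).1.2.1
  obtain rfl : β = β' := by
    ext t
    simpa using (H t 0 0 0).1.2.2
  obtain rfl : μ = μ' := by
    ext t
    simpa using (H t 0 0 1).2.1
  obtain rfl : δ = δ' := by
    ext t
    simpa using (H t 0 0 0).2.2.2
  obtain rfl : γ = γ' := by
    ext t
    simpa using (H t 1 0 0).2.2.2
  simp

/-! ### The symmetry condition in coordinates -/

/-- The second derivative of `F` at `z` in the direction `v`. -/
def sd (F : J0 → ℝ) (z v : J0) : ℝ := fderiv ℝ (fun y => fderiv ℝ F y v) z v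

theorem VF.contDiff_fst (V : VF) (k : Fin 3) : ContDiff ℝ ∞ fun z => (V.1 z).1 k :=
  contDiff_pi.1 (ContDiff.fst V.contDiff) k

theorem VF.contDiff_snd (V : VF) (a : Fin 3) : ContDiff ℝ ∞ fun z => (V.1 z).2 a :=
  contDiff_pi.1 (ContDiff.snd V.contDiff) a

/-- The direction of the total derivative `Dᵢ` in the space of variables. -/
def lift (p : Fin 3 → Fin 3 → ℝ) (i : Fin 3) : J0 := (Pi.single i 1, fun a => p a i)

theorem contDiff_totalD0 {F : J0 → ℝ} (hF : ContDiff ℝ ∞ F) (i : Fin 3) :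
    ContDiff ℝ ∞ (totalD0 F i) := by
  have h : ContDiff ℝ ∞ (fderiv ℝ F) := hF.fderiv_right (by simp)
  unfold totalD0
  fun_prop

/-- `totalD0 F i` is the differential of `F` at a moving point applied to a moving direction. The
product rule gives a second derivative from the point and a first derivative along the `q`-terms
from the direction. -/
theorem totalD1_totalD0 {F : J0 → ℝ} (hF : ContDiff ℝ ∞ F) (i : Fin 3) (j : J2) :
    totalD1 (totalD0 F i) i j =
      sd F j.1.1 (lift j.1.2 i) + fderiv ℝ F j.1.1 (0, fun a => j.2 a i i) := by
  have h : ContDiff ℝ ∞ (fderiv ℝ F) := hF.fderiv_right (by simp)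
  have hd : Differentiable ℝ (fderiv ℝ F) := h.differentiable (by simp)
  refine fderiv_apply_of_line ((contDiff_totalD0 hF i).differentiable (by simp) _) ?_
  have l : HasDerivAt (fun s : ℝ => j.1.1 + s • lift j.1.2 i) (lift j.1.2 i) 0 := by
    simpa using ((hasDerivAt_id (0 : ℝ)).smul_const (lift j.1.2 i)).const_add j.1.1
  have h1 : HasDerivAt (fun s : ℝ => fderiv ℝ F (j.1.1 + s • lift j.1.2 i))
      (fderiv ℝ (fderiv ℝ F) j.1.1 (lift j.1.2 i)) 0 := by
    refine HasFDerivAt.comp_hasDerivAt (0 : ℝ) (l := fderiv ℝ F) ?_ l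
    simpa using (hd j.1.1).hasFDerivAt
  have h2 : HasDerivAt (fun s : ℝ => lift j.1.2 i + s • ((0, fun a => j.2 a i i) : J0))
      (0, fun a => j.2 a i i) 0 := by
    simpa using ((hasDerivAt_id (0 : ℝ)).smul_const ((0, fun a => j.2 a i i) : J0)).const_add
      (lift j.1.2 i)
  have key := h1.clm_apply h2
  refine (key.congr_deriv ?_).congr_of_eventuallyEq (.of_forall fun s => ?_)
  · have e : sd F j.1.1 (lift j.1.2 i)
        = fderiv ℝ (fderiv ℝ F) j.1.1 (lift j.1.2 i) (lift j.1.2 i) := by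
      have := ((hd j.1.1).hasFDerivAt.clm_apply (hasFDerivAt_const (lift j.1.2 i) j.1.1)).fderiv
      rw [sd, this]
      simp
    rw [e]
    simp
  · simp [totalD0, lift]
    rfl

theorem totalD1_prol1 (V : VF) (a i : Fin 3) (j : J2) :
    totalD1 (prol1 V.1 a i) i j = totalD1 (totalD0 (fun z => (V.1 z).2 a) i) i j
      - ∑ k, (totalD1 (totalD0 (fun z => (V.1 z).1 k) i) i j * j.1.2 a k
        + totalD0 (fun z => (V.1 z).1 k) i j.1 * j.2 a k i) := by
  have hη := ((contDiff_totalD0 (V.contDiff_snd a) i).differentiable (by simp) j.1).hasFDerivAt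
  have hξ := fun k =>
    ((contDiff_totalD0 (V.contDiff_fst k) i).differentiable (by simp) j.1).hasFDerivAt
  have hp : ∀ k, HasFDerivAt (fun y : J1 => y.2 a k)
      ((ContinuousLinearMap.proj k).comp ((ContinuousLinearMap.proj a).comp
        (ContinuousLinearMap.snd ℝ J0 (Fin 3 → Fin 3 → ℝ)))) j.1 := fun k =>
    ((ContinuousLinearMap.proj (R := ℝ) (φ := fun _ : Fin 3 => ℝ) k).comp
      ((ContinuousLinearMap.proj (R := ℝ) (φ := fun _ : Fin 3 => Fin 3 → ℝ) a).comp
        (ContinuousLinearMap.snd ℝ J0 (Fin 3 → Fin 3 → ℝ)))).hasFDerivAt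
  have h := (hη.sub (HasFDerivAt.fun_sum (u := Finset.univ)
    fun k _ => (hξ k).mul (hp k))).fderiv
  have e : prol1 V.1 a i = totalD0 (fun z => (V.1 z).2 a) i
    - fun y => ∑ k, (totalD0 (fun z => (V.1 z).1 k) i * fun y : J1 => y.2 a k) y := rfl
  unfold totalD1
  rw [e]
  erw [h]
  simp only [sub_apply, sum_apply,
    add_apply, smul_apply, smul_eq_mul,
    ContinuousLinearMap.comp_apply, ContinuousLinearMap.coe_snd', ContinuousLinearMap.proj_apply]
  congr 1
  exact Finset.sum_congr rfl fun k _ => by ring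

/-- Symmetry of the second derivatives merges the two terms `(Dᵢ ξᵏ) wᵃₖᵢ` and `(Dᵢ ξᵏ) wᵃᵢₖ` into
one with the factor 2. Only the repeated index `i i` is needed, as the system has no mixed second
derivatives. -/
theorem prol2_eq (V : VF) (a i : Fin 3) (j : J2) (hq : ∀ a i k, j.2 a i k = j.2 a k i) :
    prol2 V.1 a i i j = sd (fun z => (V.1 z).2 a) j.1.1 (lift j.1.2 i)
      + fderiv ℝ (fun z => (V.1 z).2 a) j.1.1 (0, fun b => j.2 b i i)
      - ∑ k, ((sd (fun z => (V.1 z).1 k) j.1.1 (lift j.1.2 i)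
          + fderiv ℝ (fun z => (V.1 z).1 k) j.1.1 (0, fun b => j.2 b i i)) * j.1.2 a k
        + 2 * fderiv ℝ (fun z => (V.1 z).1 k) j.1.1 (lift j.1.2 i) * j.2 a i k) := by
  unfold prol2
  rw [totalD1_prol1, totalD1_totalD0 (V.contDiff_snd a), sub_sub, ← Finset.sum_add_distrib]
  congr 1
  refine Finset.sum_congr rfl fun k _ => ?_
  rw [totalD1_totalD0 (V.contDiff_fst k), hq a k i, totalD0]
  simp only [lift]
  ring

theorem system_eq (ε₁ ε₂ δ₁ δ₂ : ℝ) (j : J2) :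
    system ε₁ ε₂ δ₁ δ₂ j =
      ![-j.1.2 1 0 + j.2 0 1 1 + ε₁ * j.2 0 2 2
          - ε₂ * (j.1.1.2 0 ^ 2 + j.1.1.2 1 ^ 2) * j.1.1.2 0 - j.1.1.2 0 * j.1.2 2 2,
        j.1.2 0 0 + j.2 1 1 1 + ε₁ * j.2 1 2 2
          - ε₂ * (j.1.1.2 0 ^ 2 + j.1.1.2 1 ^ 2) * j.1.1.2 1 - j.1.1.2 1 * j.1.2 2 2,
        j.2 2 1 1 + δ₁ * j.2 2 2 2
          - δ₂ * (2 * (j.1.1.2 0 * j.1.2 0 2 + j.1.1.2 1 * j.1.2 1 2))] := by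
  ext i
  fin_cases i <;> simp [system, Complex.normSq_apply] <;> ring

theorem fderiv_system (ε₁ ε₂ δ₁ δ₂ : ℝ) (j k : J2) :
    fderiv ℝ (system ε₁ ε₂ δ₁ δ₂) j k =
      ![-k.1.2 1 0 + k.2 0 1 1 + ε₁ * k.2 0 2 2
          - ε₂ * ((3 * j.1.1.2 0 ^ 2 + j.1.1.2 1 ^ 2) * k.1.1.2 0
            + 2 * j.1.1.2 0 * j.1.1.2 1 * k.1.1.2 1)
          - (k.1.1.2 0 * j.1.2 2 2 + j.1.1.2 0 * k.1.2 2 2),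
        k.1.2 0 0 + k.2 1 1 1 + ε₁ * k.2 1 2 2
          - ε₂ * ((j.1.1.2 0 ^ 2 + 3 * j.1.1.2 1 ^ 2) * k.1.1.2 1
            + 2 * j.1.1.2 0 * j.1.1.2 1 * k.1.1.2 0)
          - (k.1.1.2 1 * j.1.2 2 2 + j.1.1.2 1 * k.1.2 2 2),
        k.2 2 1 1 + δ₁ * k.2 2 2 2
          - 2 * δ₂ * (k.1.1.2 0 * j.1.2 0 2 + j.1.1.2 0 * k.1.2 0 2
            + k.1.1.2 1 * j.1.2 1 2 + j.1.1.2 1 * k.1.2 1 2)] := by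
  have hs := funext (system_eq ε₁ ε₂ δ₁ δ₂)
  refine fderiv_apply_of_line ?_ ?_
  · rw [hs, differentiableAt_pi]
    intro i
    fin_cases i <;> dsimp <;> fun_prop
  · rw [hs, hasDerivAt_pi]
    have w := fun a => hasDerivAt_line (j.1.1.2 a) (k.1.1.2 a)
    have p := fun a i => hasDerivAt_line (j.1.2 a i) (k.1.2 a i)
    have q := fun a i l => hasDerivAt_line (j.2 a i l) (k.2 a i l)
    have n := (((w 0).pow 2).add ((w 1).pow 2)).const_mul ε₂
    intro i
    fin_cases i
    · refine (((((p 1 0).neg.add (q 0 1 1)).add ((q 0 2 2).const_mul ε₁)).sub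
        (n.mul (w 0))).sub ((w 0).mul (p 2 2))).congr_deriv ?_
      simp
      ring
    · refine (((((p 0 0).add (q 1 1 1)).add ((q 1 2 2).const_mul ε₁)).sub
        (n.mul (w 1))).sub ((w 1).mul (p 2 2))).congr_deriv ?_
      simp
      ring
    · refine (((q 2 1 1).add ((q 2 2 2).const_mul δ₁)).sub (((((w 0).mul (p 0 2)).add
        ((w 1).mul (p 1 2))).const_mul 2).const_mul δ₂)).congr_deriv ?_
      simp
      ring

/-! ### The general element is a symmetry -/

theorem fderiv_fst_apply (V : VF) (k : Fin 3) (z v : J0) :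
    fderiv ℝ (fun y => (V.1 y).1 k) z v = (fderiv ℝ V.1 z v).1 k := by
  have h := hasFDerivAt_pi'.1 (V.differentiable z).hasFDerivAt.fst k
  rw [h.fderiv]
  rfl

theorem fderiv_snd_apply (V : VF) (a : Fin 3) (z v : J0) :
    fderiv ℝ (fun y => (V.1 y).2 a) z v = (fderiv ℝ V.1 z v).2 a := by
  have h := hasFDerivAt_pi'.1 (V.differentiable z).hasFDerivAt.snd a
  rw [h.fderiv]
  rfl

theorem differentiable_fderiv_apply {F : J0 → ℝ} (hF : ContDiff ℝ ∞ F) (v : J0) :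
    Differentiable ℝ fun y => fderiv ℝ F y v := by
  have h : ContDiff ℝ ∞ (fderiv ℝ F) := hF.fderiv_right (by simp)
  exact (h.clm_apply contDiff_const).differentiable (by simp)

/-- The `∂_t, ∂_x, ∂_y`-coefficients are affine in `x, y` at fixed `t`. Directions without a
`t`-component suffice, since the system contains only `xx`- and `yy`-derivatives. -/
theorem sd_G_fst {ε₁ : ℝ} (hε₁ : ε₁ = 1 ∨ ε₁ = -1) (δ₁ : ℝ) (τ α β μ γ δ : C) (z : J0)
    {v : J0} (hv : v.1 0 = 0) (k : Fin 3) :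
    sd (fun y => ((G ε₁ δ₁ τ α β μ γ δ).1 y).1 k) z v = 0 := by
  refine fderiv_apply_of_line
    (differentiable_fderiv_apply ((G ε₁ δ₁ τ α β μ γ δ).contDiff_fst k) v z) ?_
  simp only [fderiv_fst_apply, fderiv_G hε₁, hv]
  fin_cases k <;> simp [hv, hasDerivAt_const]

theorem sd_G_snd_zero {ε₁ : ℝ} (hε₁ : ε₁ = 1 ∨ ε₁ = -1) (δ₁ : ℝ) (τ α β μ γ δ : C) (z : J0)
    {v : J0} (hv : v.1 0 = 0) :
    sd (fun y => ((G ε₁ δ₁ τ α β μ γ δ).1 y).2 0) z v =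
      -((v.1 1 ^ 2 + ε₁ * v.1 2 ^ 2) / 4 * (D (D τ)).1 (z.1 0) * z.2 1)
        - 2 * ((z.1 1 * v.1 1 + ε₁ * z.1 2 * v.1 2) / 4 * (D (D τ)).1 (z.1 0)
          + v.1 1 / 2 * (D α).1 (z.1 0) + v.1 2 / 2 * (ε₁ * (D β).1 (z.1 0))) * v.2 1 := by
  refine fderiv_apply_of_line
    (differentiable_fderiv_apply ((G ε₁ δ₁ τ α β μ γ δ).contDiff_snd 0) v z) ?_
  simp only [fderiv_snd_apply, fderiv_G hε₁, hv]
  have l := fun i => hasDerivAt_line (z.1 i) (v.1 i)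
  have m := fun i => hasDerivAt_line (z.2 i) (v.2 i)
  have hp := hasDerivAt_phase ε₁ τ α β μ (z.1 0) (z.1 1) (z.1 2) (v.1 0) (v.1 1) (v.1 2)
  have h := ((((((((l 1).mul_const (v.1 1)).add (((l 2).const_mul ε₁).mul_const (v.1 2))).div_const
    4).mul_const ((D (D τ)).1 (z.1 0))).add_const (v.1 1 / 2 * (D α).1 (z.1 0)
      + v.1 2 / 2 * (ε₁ * (D β).1 (z.1 0)))).mul (m 1)).neg.add
    (hp.mul_const (v.2 1))).add_const (-((D τ).1 (z.1 0) / 2 * v.2 0))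
  refine (h.congr_deriv ?_).congr_of_eventuallyEq (.of_forall fun s => ?_)
  · simp [hv]
    ring
  · simp [hv]
    ring

theorem sd_G_snd_one {ε₁ : ℝ} (hε₁ : ε₁ = 1 ∨ ε₁ = -1) (δ₁ : ℝ) (τ α β μ γ δ : C) (z : J0)
    {v : J0} (hv : v.1 0 = 0) :
    sd (fun y => ((G ε₁ δ₁ τ α β μ γ δ).1 y).2 1) z v =
      (v.1 1 ^ 2 + ε₁ * v.1 2 ^ 2) / 4 * (D (D τ)).1 (z.1 0) * z.2 0
        + 2 * ((z.1 1 * v.1 1 + ε₁ * z.1 2 * v.1 2) / 4 * (D (D τ)).1 (z.1 0)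
          + v.1 1 / 2 * (D α).1 (z.1 0) + v.1 2 / 2 * (ε₁ * (D β).1 (z.1 0))) * v.2 0 := by
  refine fderiv_apply_of_line
    (differentiable_fderiv_apply ((G ε₁ δ₁ τ α β μ γ δ).contDiff_snd 1) v z) ?_
  simp only [fderiv_snd_apply, fderiv_G hε₁, hv]
  have l := fun i => hasDerivAt_line (z.1 i) (v.1 i)
  have m := fun i => hasDerivAt_line (z.2 i) (v.2 i)
  have hp := hasDerivAt_phase ε₁ τ α β μ (z.1 0) (z.1 1) (z.1 2) (v.1 0) (v.1 1) (v.1 2)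
  have h := ((((((((l 1).mul_const (v.1 1)).add (((l 2).const_mul ε₁).mul_const (v.1 2))).div_const
    4).mul_const ((D (D τ)).1 (z.1 0))).add_const (v.1 1 / 2 * (D α).1 (z.1 0)
      + v.1 2 / 2 * (ε₁ * (D β).1 (z.1 0)))).mul (m 0)).sub
    (hp.mul_const (v.2 0))).add_const (-((D τ).1 (z.1 0) / 2 * v.2 1))
  refine (h.congr_deriv ?_).congr_of_eventuallyEq (.of_forall fun s => ?_)
  · simp [hv]
    ring
  · simp [hv]
    ring

theorem sd_G_snd_two {ε₁ : ℝ} (hε₁ : ε₁ = 1 ∨ ε₁ = -1) (δ₁ : ℝ) (τ α β μ γ δ : C) (z : J0)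
    {v : J0} (hv : v.1 0 = 0) :
    sd (fun y => ((G ε₁ δ₁ τ α β μ γ δ).1 y).2 2) z v =
      -((D (D (D τ))).1 (z.1 0) / 4
          * (z.1 2 * v.1 1 ^ 2 + 2 * z.1 1 * v.1 1 * v.1 2 + ε₁ * z.1 2 * v.1 2 ^ 2))
        - v.1 1 * v.1 2 * (D (D α)).1 (z.1 0)
        + ε₁ * (D (D β)).1 (z.1 0) / 2 * (δ₁ * v.1 1 ^ 2 - v.1 2 ^ 2) := by
  refine fderiv_apply_of_line
    (differentiable_fderiv_apply ((G ε₁ δ₁ τ α β μ γ δ).contDiff_snd 2) v z) ?_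
  simp only [fderiv_snd_apply, fderiv_G hε₁, hv]
  have l := fun i => hasDerivAt_line (z.1 i) (v.1 i)
  have h := ((((((((l 1).mul (l 2)).const_mul (2 * v.1 1)).add ((((l 1).pow 2).add
      (((l 2).pow 2).const_mul ε₁)).mul_const (v.1 2))).const_mul
      (-(D (D (D τ))).1 (z.1 0) / 8)).sub
    ((((l 1).mul_const (v.1 2)).add ((l 2).mul_const (v.1 1))).mul_const
      ((D (D α)).1 (z.1 0) / 2))).add
    ((((l 1).const_mul (δ₁ * v.1 1)).sub ((l 2).mul_const (v.1 2))).const_mul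
      (ε₁ * (D (D β)).1 (z.1 0) / 2))).add_const
    (-((D τ).1 (z.1 0) / 2 * v.2 2) + v.1 2 * (D μ).1 (z.1 0) + v.1 1 * γ.1 (z.1 0)))
  refine (h.congr_deriv ?_).congr_of_eventuallyEq (.of_forall fun s => ?_)
  · simp
    ring
  · simp [hv]
    ring

theorem isSymmetry_G {ε₁ δ₁ : ℝ} (hε₁ : ε₁ = 1 ∨ ε₁ = -1) (ε₂ δ₂ : ℝ) {τ : C}
    (α β μ γ δ : C) (hτ : (ε₁ + δ₁) • D (D (D τ)) = 0) :
    IsSymmetry ε₁ ε₂ δ₁ δ₂ (G ε₁ δ₁ τ α β μ γ δ) := by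
  intro j hq hs
  have hc := congrArg (fun f : C => f.1 (j.1.1.1 0)) hτ
  simp only [C.smul_apply, C.zero_apply] at hc
  rw [system_eq] at hs
  have h0 := congrFun hs 0
  have h1 := congrFun hs 1
  have h2 := congrFun hs 2
  have v1 : (lift j.1.2 1).1 0 = 0 := by simp [lift]
  have v2 : (lift j.1.2 2).1 0 = 0 := by simp [lift]
  rw [fderiv_system]
  simp only [prolongation, prol2_eq _ _ _ _ hq, prol1, totalD0, sd_G_fst hε₁ _ _ _ _ _ _ _ _ v1,
    sd_G_fst hε₁ _ _ _ _ _ _ _ _ v2, sd_G_snd_zero hε₁ _ _ _ _ _ _ _ _ v1,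
    sd_G_snd_zero hε₁ _ _ _ _ _ _ _ _ v2, sd_G_snd_one hε₁ _ _ _ _ _ _ _ _ v1,
    sd_G_snd_one hε₁ _ _ _ _ _ _ _ _ v2, sd_G_snd_two hε₁ _ _ _ _ _ _ _ _ v1,
    sd_G_snd_two hε₁ _ _ _ _ _ _ _ _ v2, fderiv_fst_apply, fderiv_snd_apply, fderiv_G hε₁, Fin.sum_univ_three]
  simp only [G_apply hε₁, phase, shift]
  simp [lift] at h0 h1 h2 ⊢
  have k0 := congrArg (phase ε₁ τ α β μ (j.1.1.1 0) (j.1.1.1 1) (j.1.1.1 2) * ·) h0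
  have k1 := congrArg (phase ε₁ τ α β μ (j.1.1.1 0) (j.1.1.1 1) (j.1.1.1 2) * ·) h1
  simp only [phase, mul_zero] at k0 k1
  refine ⟨?_, ?_, ?_⟩
  -- The multiplier `-(3/2) τ'` is the weight of the equation: `-τ'/2` from `ψ` and `-τ'` from two
  -- space derivatives. The terms `k1` and `-k0` are the rotation of the real and imaginary parts
  -- into each other.
  · rcases hε₁ with rfl | rfl <;>
      linear_combination -(3 / 2) * (D τ).1 (j.1.1.1 0) * h0 + k1
  · rcases hε₁ with rfl | rfl <;>
      linear_combination -(3 / 2) * (D τ).1 (j.1.1.1 0) * h1 - k0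
  -- Besides the weight, there remains the `xx + δ₁ yy` part of the cubic in `X(τ)`, equal to
  -- `-(y/4) ε₁ (ε₁ + δ₁) τ'''`.
  · rcases hε₁ with rfl | rfl
    · linear_combination -(3 / 2) * (D τ).1 (j.1.1.1 0) * h2 - j.1.1.1 2 / 4 * hc
    · linear_combination -(3 / 2) * (D τ).1 (j.1.1.1 0) * h2 + j.1.1.1 2 / 4 * hc

/-! ### Partial derivatives -/

/-- The derivative of `F` in the direction `v`. -/
def pd (v : J0) (F : J0 → ℝ) (z : J0) : ℝ := fderiv ℝ F z v

/-- The coordinate direction of `t`. -/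
def et : J0 := (![1, 0, 0], ![0, 0, 0])
/-- The coordinate direction of `x`. -/
def ex : J0 := (![0, 1, 0], ![0, 0, 0])
/-- The coordinate direction of `y`. -/
def ey : J0 := (![0, 0, 1], ![0, 0, 0])
/-- The coordinate direction of `u`. -/
def eu : J0 := (![0, 0, 0], ![1, 0, 0])
/-- The coordinate direction of `v`. -/
def ev : J0 := (![0, 0, 0], ![0, 1, 0])
/-- The coordinate direction of `φ`. -/
def ew : J0 := (![0, 0, 0], ![0, 0, 1])

theorem contDiff_pd {F : J0 → ℝ} (hF : ContDiff ℝ ∞ F) (v : J0) : ContDiff ℝ ∞ (pd v F) := by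
  have h : ContDiff ℝ ∞ (fderiv ℝ F) := hF.fderiv_right (by simp)
  exact h.clm_apply contDiff_const

theorem pd_comm {F : J0 → ℝ} (hF : ContDiff ℝ ∞ F) (v w : J0) :
    pd v (pd w F) = pd w (pd v F) := by
  funext z
  have h : ContDiff ℝ ∞ (fderiv ℝ F) := hF.fderiv_right (by simp)
  have hd : DifferentiableAt ℝ (fderiv ℝ F) z := h.differentiable (by simp) z
  have e : ∀ v w, pd v (pd w F) z = fderiv ℝ (fderiv ℝ F) z v w := by
    intro v w
    have := (hd.hasFDerivAt.clm_apply (hasFDerivAt_const w z)).fderiv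
    change fderiv ℝ (fun y => fderiv ℝ F y w) z v = _
    rw [this]
    simp
  rw [e, e]
  refine (hF.contDiffAt.isSymmSndFDerivAt ?_).eq v w
  rw [minSmoothness_of_isRCLikeNormedField]
  exact WithTop.coe_le_coe.2 le_top

theorem pd_zero (v : J0) : pd v (fun _ => 0) = fun _ => 0 := by
  funext z
  simp [pd]

theorem pd_add_dir (v w : J0) (F : J0 → ℝ) (z : J0) : pd (v + w) F z = pd v F z + pd w F z :=
  map_add _ _ _

theorem pd_smul_dir (c : ℝ) (v : J0) (F : J0 → ℝ) (z : J0) : pd (c • v) F z = c * pd v F z :=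
  map_smul _ _ _

theorem pd_add_smul {F₀ F₁ F₂ F₃ : J0 → ℝ} (h₀ : ContDiff ℝ ∞ F₀) (h₁ : ContDiff ℝ ∞ F₁)
    (h₂ : ContDiff ℝ ∞ F₂) (h₃ : ContDiff ℝ ∞ F₃) (a b c : ℝ) (v z : J0) :
    pd v (fun y => F₀ y + a * F₁ y + b * F₂ y + c * F₃ y) z
      = pd v F₀ z + a * pd v F₁ z + b * pd v F₂ z + c * pd v F₃ z := by
  have d₀ := (h₀.differentiable (by simp) z).hasFDerivAt
  have d₁ := (h₁.differentiable (by simp) z).hasFDerivAt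
  have d₂ := (h₂.differentiable (by simp) z).hasFDerivAt
  have d₃ := (h₃.differentiable (by simp) z).hasFDerivAt
  have h := congrArg (fun T => T v) (((d₀.add (d₁.const_mul a)).add (d₂.const_mul b)).add
    (d₃.const_mul c)).fderiv
  refine h.trans ?_
  simp [pd]

theorem pd_vertical (w : Fin 3 → ℝ) (F : J0 → ℝ) (z : J0) :
    fderiv ℝ F z (0, w) = w 0 * pd eu F z + w 1 * pd ev F z + w 2 * pd ew F z := by
  have : ((0, w) : J0) = w 0 • eu + w 1 • ev + w 2 • ew := by
    ext i <;> fin_cases i <;> simp [eu, ev, ew]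
  rw [this, ← pd, pd_add_dir, pd_add_dir, pd_smul_dir, pd_smul_dir, pd_smul_dir]

/-- The coordinate directions of the independent variables. -/
def dir : Fin 3 → J0 := ![et, ex, ey]

theorem lift_eq (p : Fin 3 → Fin 3 → ℝ) (i : Fin 3) :
    lift p i = dir i + p 0 i • eu + p 1 i • ev + p 2 i • ew := by
  ext k <;> fin_cases i <;> fin_cases k <;> simp [lift, dir, et, ex, ey, eu, ev, ew]

theorem pd_lift (p : Fin 3 → Fin 3 → ℝ) (i : Fin 3) (F : J0 → ℝ) (z : J0) :
    fderiv ℝ F z (lift p i)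
      = pd (dir i) F z + p 0 i * pd eu F z + p 1 i * pd ev F z + p 2 i * pd ew F z := by
  rw [lift_eq, ← pd]
  simp only [pd_add_dir, pd_smul_dir]

/-- This makes the dependence on the first derivatives explicit: a polynomial of degree two in `p`,
whose coefficients can be separated by evaluation at special `p`. -/
theorem sd_lift {F : J0 → ℝ} (hF : ContDiff ℝ ∞ F) (p : Fin 3 → Fin 3 → ℝ) (i : Fin 3) (z : J0) :
    sd F z (lift p i) = pd (dir i) (pd (dir i) F) z
      + 2 * (p 0 i * pd (dir i) (pd eu F) z + p 1 i * pd (dir i) (pd ev F) z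
        + p 2 i * pd (dir i) (pd ew F) z)
      + p 0 i ^ 2 * pd eu (pd eu F) z + p 1 i ^ 2 * pd ev (pd ev F) z
      + p 2 i ^ 2 * pd ew (pd ew F) z
      + 2 * (p 0 i * p 1 i * pd eu (pd ev F) z + p 0 i * p 2 i * pd eu (pd ew F) z
        + p 1 i * p 2 i * pd ev (pd ew F) z) := by
  have h := fun v => contDiff_pd hF v
  unfold sd
  simp only [pd_lift]
  rw [pd_add_smul (h _) (h _) (h _) (h _), pd_add_smul (h _) (h _) (h _) (h _),
    pd_add_smul (h _) (h _) (h _) (h _), pd_add_smul (h _) (h _) (h _) (h _),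
    pd_comm hF eu (dir i), pd_comm hF ev (dir i), pd_comm hF ew (dir i), pd_comm hF ev eu,
    pd_comm hF ew eu, pd_comm hF ew ev]
  ring

/-! ### The determining equations -/

/-- The coefficients of the vector field at `∂_t, ∂_x, ∂_y`. -/
def xi (V : VF) (k : Fin 3) : J0 → ℝ := fun z => (V.1 z).1 k

/-- The coefficients of the vector field at `∂_u, ∂_v, ∂_φ`. -/
def eta (V : VF) (a : Fin 3) : J0 → ℝ := fun z => (V.1 z).2 a

theorem contDiff_xi (V : VF) (k : Fin 3) : ContDiff ℝ ∞ (xi V k) := V.contDiff_fst k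

theorem contDiff_eta (V : VF) (a : Fin 3) : ContDiff ℝ ∞ (eta V a) := V.contDiff_snd a

/-- The first prolongation coefficient in terms of directional derivatives. -/
def eta1 (V : VF) (z : J0) (p : Fin 3 → Fin 3 → ℝ) (a i : Fin 3) : ℝ :=
  fderiv ℝ (eta V a) z (lift p i) - (fderiv ℝ (xi V 0) z (lift p i) * p a 0
    + fderiv ℝ (xi V 1) z (lift p i) * p a 1 + fderiv ℝ (xi V 2) z (lift p i) * p a 2)

/-- The second prolongation coefficient in the direction `i`, at a jet whose second derivatives are
`r b = ∂ᵢ∂ᵢ wᵇ` and `s k = ∂ᵢ∂ₖ wᵃ`. -/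
def eta2 (V : VF) (z : J0) (p : Fin 3 → Fin 3 → ℝ) (r s : Fin 3 → ℝ) (a i : Fin 3) : ℝ :=
  sd (eta V a) z (lift p i) + fderiv ℝ (eta V a) z (0, r)
    - ((sd (xi V 0) z (lift p i) + fderiv ℝ (xi V 0) z (0, r)) * p a 0
      + (sd (xi V 1) z (lift p i) + fderiv ℝ (xi V 1) z (0, r)) * p a 1
      + (sd (xi V 2) z (lift p i) + fderiv ℝ (xi V 2) z (0, r)) * p a 2)
    - 2 * (fderiv ℝ (xi V 0) z (lift p i) * s 0 + fderiv ℝ (xi V 1) z (lift p i) * s 1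
      + fderiv ℝ (xi V 2) z (lift p i) * s 2)

/-- The second derivatives with respect to `x` determined by the system from the other data. -/
def solved (ε₁ ε₂ δ₁ δ₂ : ℝ) (z : J0) (p : Fin 3 → Fin 3 → ℝ) (yy : Fin 3 → ℝ) : Fin 3 → ℝ :=
  ![p 1 0 + ε₂ * (z.2 0 ^ 2 + z.2 1 ^ 2) * z.2 0 + z.2 0 * p 2 2 - ε₁ * yy 0,
    -p 0 0 + ε₂ * (z.2 0 ^ 2 + z.2 1 ^ 2) * z.2 1 + z.2 1 * p 2 2 - ε₁ * yy 1,
    δ₂ * (2 * (z.2 0 * p 0 2 + z.2 1 * p 1 2)) - δ₁ * yy 2]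

/-- Jets satisfying the system are parametrized by their free coordinates, with the `xx`-derivatives
given by `solved`; the invariance condition thereby becomes an identity valid for all values of the
parameters. -/
theorem IsSymmetry.equations {ε₁ ε₂ δ₁ δ₂ : ℝ} {V : VF} (hV : IsSymmetry ε₁ ε₂ δ₁ δ₂ V) (z : J0)
    (p : Fin 3 → Fin 3 → ℝ) (tx ty xy yy : Fin 3 → ℝ) {r : Fin 3 → ℝ}
    (hr : r = solved ε₁ ε₂ δ₁ δ₂ z p yy) :
    -eta1 V z p 1 0 + eta2 V z p r ![tx 0, r 0, xy 0] 0 1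
        + ε₁ * eta2 V z p yy ![ty 0, xy 0, yy 0] 0 2
        - ε₂ * ((3 * z.2 0 ^ 2 + z.2 1 ^ 2) * eta V 0 z + 2 * z.2 0 * z.2 1 * eta V 1 z)
        - (eta V 0 z * p 2 2 + z.2 0 * eta1 V z p 2 2) = 0 ∧
    eta1 V z p 0 0 + eta2 V z p r ![tx 1, r 1, xy 1] 1 1
        + ε₁ * eta2 V z p yy ![ty 1, xy 1, yy 1] 1 2
        - ε₂ * ((z.2 0 ^ 2 + 3 * z.2 1 ^ 2) * eta V 1 z + 2 * z.2 0 * z.2 1 * eta V 0 z)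
        - (eta V 1 z * p 2 2 + z.2 1 * eta1 V z p 2 2) = 0 ∧
    eta2 V z p r ![tx 2, r 2, xy 2] 2 1 + δ₁ * eta2 V z p yy ![ty 2, xy 2, yy 2] 2 2
        - 2 * δ₂ * (eta V 0 z * p 0 2 + z.2 0 * eta1 V z p 0 2
          + eta V 1 z * p 1 2 + z.2 1 * eta1 V z p 1 2) = 0 := by
  -- The `tt`-derivatives occur neither in the system nor in the prolongation coefficients used, so
  -- they are set to 0.
  let q : Fin 3 → Fin 3 → Fin 3 → ℝ := fun a =>
    ![![0, tx a, ty a], ![tx a, r a, xy a], ![ty a, xy a, yy a]]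
  have hq : ∀ a i k, q a i k = q a k i := by
    intro a i k
    fin_cases i <;> fin_cases k <;> rfl
  have hs : system ε₁ ε₂ δ₁ δ₂ ((z, p), q) = 0 := by
    rw [system_eq]
    ext i
    fin_cases i <;> simp [q, hr, solved] <;> ring
  have h := hV ((z, p), q) hq hs
  rw [fderiv_system] at h
  have e1 : ∀ a i, prol1 V.1 a i (z, p) = eta1 V z p a i := by
    intro a i
    simp only [prol1, totalD0, Fin.sum_univ_three]
    rfl
  have e2 : ∀ a, prol2 V.1 a 1 1 ((z, p), q) = eta2 V z p r ![tx a, r a, xy a] a 1 := by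
    intro a
    rw [prol2_eq _ _ _ _ hq]
    unfold eta2 eta xi
    simp [Fin.sum_univ_three, q]
    ring
  have e3 : ∀ a, prol2 V.1 a 2 2 ((z, p), q) = eta2 V z p yy ![ty a, xy a, yy a] a 2 := by
    intro a
    rw [prol2_eq _ _ _ _ hq]
    unfold eta2 eta xi
    simp [Fin.sum_univ_three, q]
    ring
  have h0 := congrFun h 0
  have h1 := congrFun h 1
  have h2 := congrFun h 2
  simp only [prolongation, e1, e2, e3] at h0 h1 h2
  exact ⟨h0, h1, h2⟩

section determining

variable {ε₁ ε₂ δ₁ δ₂ : ℝ} {V : VF}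

/-- The three quantities are, up to the factor `-2`, the coefficients of `u_tx`, `u_ty` and `u_xy`
in the first equation, obtained by subtracting its value where these derivatives vanish. -/
theorem IsSymmetry.fderiv_xi_lift (hV : IsSymmetry ε₁ ε₂ δ₁ δ₂ V) (z : J0)
    (p : Fin 3 → Fin 3 → ℝ) :
    fderiv ℝ (xi V 0) z (lift p 1) = 0 ∧ ε₁ * fderiv ℝ (xi V 0) z (lift p 2) = 0 ∧
      fderiv ℝ (xi V 2) z (lift p 1) + ε₁ * fderiv ℝ (xi V 1) z (lift p 2) = 0 := by
  have b := (hV.equations z p 0 0 0 0 rfl).1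
  have tx := (hV.equations z p 1 0 0 0 rfl).1
  have ty := (hV.equations z p 0 1 0 0 rfl).1
  have xy := (hV.equations z p 0 0 1 0 rfl).1
  simp only [eta2] at b tx ty xy
  simp at b tx ty xy
  refine ⟨?_, ?_, ?_⟩ <;> linarith

/-- The relations of `fderiv_xi_lift` hold for every choice of first derivatives. Changing only the
`x`-derivatives, or only the `y`-derivatives, moves one of the two directions by `(0, w)` and
isolates its contribution. -/
theorem fderiv_xi_vertical (hε₁ : ε₁ = 1 ∨ ε₁ = -1) (hV : IsSymmetry ε₁ ε₂ δ₁ δ₂ V) (k : Fin 3)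
    (z : J0) (w : Fin 3 → ℝ) : fderiv ℝ (xi V k) z (0, w) = 0 := by
  have hε : ε₁ ≠ 0 := by rcases hε₁ with rfl | rfl <;> norm_num
  have e1 : lift (fun a => ![0, w a, 0]) 1 = lift 0 1 + (0, w) := by
    ext i <;> simp [lift]
  have e1' : lift (fun a => ![0, w a, 0]) 2 = lift 0 2 := by
    ext i <;> simp [lift]
  have e2 : lift (fun a => ![0, 0, w a]) 2 = lift 0 2 + (0, w) := by
    ext i <;> simp [lift]
  have e2' : lift (fun a => ![0, 0, w a]) 1 = lift 0 1 := by
    ext i <;> simp [lift]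
  have h0 := hV.fderiv_xi_lift z 0
  have h1 := hV.fderiv_xi_lift z (fun a => ![0, w a, 0])
  have h2 := hV.fderiv_xi_lift z (fun a => ![0, 0, w a])
  rw [e1, e1', map_add, map_add] at h1
  rw [e2, e2', map_add, map_add] at h2
  fin_cases k
  · exact (by linarith [h0.1, h1.1] : fderiv ℝ (xi V 0) z (0, w) = 0)
  · have : ε₁ * fderiv ℝ (xi V 1) z (0, w) = 0 := by linarith [h0.2.2, h2.2.2]
    exact (mul_eq_zero.1 this).resolve_left hε
  · exact (by linarith [h0.2.2, h1.2.2] : fderiv ℝ (xi V 2) z (0, w) = 0)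

theorem pd_xi_vertical (hε₁ : ε₁ = 1 ∨ ε₁ = -1) (hV : IsSymmetry ε₁ ε₂ δ₁ δ₂ V) (k : Fin 3) :
    pd eu (xi V k) = (fun _ => 0) ∧ pd ev (xi V k) = (fun _ => 0) ∧
      pd ew (xi V k) = fun _ => 0 := by
  have h := fderiv_xi_vertical hε₁ hV k
  refine ⟨funext fun z => ?_, funext fun z => ?_, funext fun z => ?_⟩
  · exact (by simp [eu] : eu = (0, ![1, 0, 0])) ▸ h z ![1, 0, 0]
  · exact (by simp [ev] : ev = (0, ![0, 1, 0])) ▸ h z ![0, 1, 0]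
  · exact (by simp [ew] : ew = (0, ![0, 0, 1])) ▸ h z ![0, 0, 1]

theorem pd_xi_horizontal (hε₁ : ε₁ = 1 ∨ ε₁ = -1) (hV : IsSymmetry ε₁ ε₂ δ₁ δ₂ V) :
    pd ex (xi V 0) = (fun _ => 0) ∧ pd ey (xi V 0) = (fun _ => 0) ∧
      ∀ z, pd ex (xi V 2) z + ε₁ * pd ey (xi V 1) z = 0 := by
  have hε : ε₁ ≠ 0 := by rcases hε₁ with rfl | rfl <;> norm_num
  have h : ∀ z, pd ex (xi V 0) z = 0 ∧ pd ey (xi V 0) z = 0 ∧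
      pd ex (xi V 2) z + ε₁ * pd ey (xi V 1) z = 0 := by
    intro z
    have h := hV.fderiv_xi_lift z 0
    simp only [pd_lift, dir] at h
    simpa [hε] using h
  exact ⟨funext fun z => (h z).1, funext fun z => (h z).2.1, fun z => (h z).2.2⟩

/-- The determining equations that come from the terms of the highest order. -/
theorem pd_eta_first (hε₁ : ε₁ = 1 ∨ ε₁ = -1) (hV : IsSymmetry ε₁ ε₂ δ₁ δ₂ V) (z : J0) :
    pd eu (eta V 1) z = -pd ev (eta V 0) z ∧ pd ew (eta V 0) z = 0 ∧ pd ew (eta V 1) z = 0 ∧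
      pd eu (eta V 2) z = 0 ∧ pd ev (eta V 2) z = 0 ∧ pd ev (eta V 1) z = pd eu (eta V 0) z ∧
      pd et (xi V 0) z = 2 * pd ex (xi V 1) z ∧ pd ey (xi V 2) z = pd ex (xi V 1) z := by
  obtain ⟨x0, y0, -⟩ := pd_xi_horizontal hε₁ hV
  have v := pd_xi_vertical hε₁ hV
  have cx := contDiff_xi V
  have H := fun p yy => hV.equations z p 0 0 0 yy rfl
  simp only [eta2, eta1, pd_lift, pd_vertical, sd_lift (contDiff_eta V _), sd_lift (cx _), dir,
    solved, (v _).1, (v _).2.1, (v _).2.2] at H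
  simp [x0, y0, pd_zero] at H
  -- The jet with all free derivatives zero is the base value. The others switch on one of `u_t,
  -- v_t, φ_t, u_yy`, and their differences from the base are the wanted coefficients.
  have b := H 0 0
  have p0 := H (fun a => if a = 0 then ![1, 0, 0] else 0) 0
  have p1 := H (fun a => if a = 1 then ![1, 0, 0] else 0) 0
  have p2 := H (fun a => if a = 2 then ![1, 0, 0] else 0) 0
  have yy := H 0 ![1, 0, 0]
  simp at b p0 p1 p2 yy
  refine ⟨?_, ?_, ?_, ?_, ?_, ?_, ?_, ?_⟩
  · linarith [b.1, p0.1]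
  · linarith [b.2.1, p2.2.1]
  · linarith [b.1, p2.1]
  · linarith [b.2.2, p1.2.2]
  · linarith [b.2.2, p0.2.2]
  · linarith [b.1, p1.1, b.2.1, p0.2.1]
  · linarith [b.1, p1.1, b.2.1, p0.2.1]
  · have : ε₁ * (pd ey (xi V 2) z - pd ex (xi V 1) z) = 0 := by linarith [b.1, yy.1]
    rcases hε₁ with rfl | rfl <;> linarith

set_option maxHeartbeats 1000000 in
/-- The determining equations that come from the terms with first derivatives with respect to `x`
and `y`, and from the terms without derivatives. -/
theorem pd_eta_second (hε₁ : ε₁ = 1 ∨ ε₁ = -1) (hV : IsSymmetry ε₁ ε₂ δ₁ δ₂ V) (z : J0) :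
    (pd eu (pd eu (eta V 0)) z = 0 ∧ pd eu (pd ev (eta V 0)) z = 0 ∧
      pd ev (pd ev (eta V 0)) z = 0) ∧
    2 * pd ex (pd eu (eta V 0)) z = pd ex (pd ex (xi V 1)) z + ε₁ * pd ey (pd ey (xi V 1)) z ∧
    2 * ε₁ * pd ey (pd eu (eta V 0)) z
      = pd ex (pd ex (xi V 2)) z + ε₁ * pd ey (pd ey (xi V 2)) z ∧
    2 * pd ex (pd ev (eta V 0)) z = -pd et (xi V 1) z ∧
    2 * ε₁ * pd ey (pd ev (eta V 0)) z = -pd et (xi V 2) z ∧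
    z.2 0 * pd ey (xi V 1) z = 0 ∧
    eta V 0 z = z.2 0 * (pd eu (eta V 0) z - pd ex (xi V 1) z - pd ew (eta V 2) z)
      + z.2 1 * pd ev (eta V 0) z ∧
    eta V 1 z = z.2 1 * (pd eu (eta V 0) z - pd ex (xi V 1) z - pd ew (eta V 2) z)
      - z.2 0 * pd ev (eta V 0) z ∧
    -pd et (eta V 1) z + pd ex (pd ex (eta V 0)) z + ε₁ * pd ey (pd ey (eta V 0)) z
      + ε₂ * (z.2 0 ^ 2 + z.2 1 ^ 2) * (z.2 0 * (pd eu (eta V 0) z - 2 * pd ex (xi V 1) z)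
        + z.2 1 * pd ev (eta V 0) z)
      - ε₂ * ((3 * z.2 0 ^ 2 + z.2 1 ^ 2) * eta V 0 z + 2 * z.2 0 * z.2 1 * eta V 1 z)
      - z.2 0 * pd ey (eta V 2) z = 0 ∧
    pd ex (pd ex (eta V 2)) z + δ₁ * pd ey (pd ey (eta V 2)) z
      - 2 * δ₂ * (z.2 0 * pd ey (eta V 0) z + z.2 1 * pd ey (eta V 1) z) = 0 := by
  obtain ⟨x0, y0, -⟩ := pd_xi_horizontal hε₁ hV
  have v := pd_xi_vertical hε₁ hV
  have f := pd_eta_first hε₁ hV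
  have w0 : pd ew (eta V 0) = fun _ => 0 := funext fun z => (f z).2.1
  have w1 : pd ew (eta V 1) = fun _ => 0 := funext fun z => (f z).2.2.1
  have u2 : pd eu (eta V 2) = fun _ => 0 := funext fun z => (f z).2.2.2.1
  have v2 : pd ev (eta V 2) = fun _ => 0 := funext fun z => (f z).2.2.2.2.1
  obtain ⟨u1, -, -, -, -, v1, -, y2⟩ := f z
  have cx := contDiff_xi V
  have H := fun p => hV.equations z p 0 0 0 0 rfl
  simp only [eta2, eta1, pd_lift, pd_vertical, sd_lift (contDiff_eta V _), sd_lift (cx _), dir,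
    solved, (v _).1, (v _).2.1, (v _).2.2, w0, w1, u2, v2] at H
  simp [x0, y0, pd_zero, u1, v1, y2] at H
  -- The identities are quadratic in each of the derivatives `u_x, v_x, u_y, v_y`: values at `1` and
  -- `-1` separate the even part (second derivatives in `u, v`) from the odd part, and `u_x = v_x =
  -- 1` gives the mixed term. Switching on `φ_x` yields the equation excluding rotations, and `φ_y`
  -- the formulas for `eta V 0` and `eta V 1`.
  have b := (H 0).1
  have p01 := (H ![![0, 1, 0], 0, 0]).1
  have p01' := (H ![![0, -1, 0], 0, 0]).1
  have p11 := (H ![0, ![0, 1, 0], 0]).1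
  have p11' := (H ![0, ![0, -1, 0], 0]).1
  have p0111 := (H ![![0, 1, 0], ![0, 1, 0], 0]).1
  have p02 := (H ![![0, 0, 1], 0, 0]).1
  have p02' := (H ![![0, 0, -1], 0, 0]).1
  have p12 := (H ![0, ![0, 0, 1], 0]).1
  have p12' := (H ![0, ![0, 0, -1], 0]).1
  have p21 := (H ![0, 0, ![0, 1, 0]]).1
  have p22 := (H ![0, 0, ![0, 0, 1]]).1
  have b1 := (H 0).2.1
  have c22 := (H ![0, 0, ![0, 0, 1]]).2.1
  have b2 := (H 0).2.2
  simp at b p01 p01' p11 p11' p0111 p02 p02' p12 p12' p21 p22 b1 c22 b2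
  have q0 : pd eu (pd eu (eta V 0)) z = 0 := by linear_combination (p01 + p01') / 2 - b
  have q1 : pd ev (pd ev (eta V 0)) z = 0 := by linear_combination (p11 + p11') / 2 - b
  refine ⟨⟨q0, ?_, q1⟩, ?_, ?_, ?_, ?_, ?_, ?_, ?_, ?_, ?_⟩
  · linear_combination (p0111 - p01 - p11 + b) / 2
  · linear_combination (p01 - p01') / 2
  · linear_combination (p02 - p02') / 2
  · linear_combination (p11 - p11') / 2
  · linear_combination (p12 - p12') / 2
  · linear_combination p21 - b
  · linear_combination b - p22
  · linear_combination b1 - c22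
  · linear_combination b
  · linear_combination b2

end determining

/-! ### Integration of the determining equations -/

/-- The point with the given coordinates. -/
def mk (t x y u v w : ℝ) : J0 := (![t, x, y], ![u, v, w])

theorem mk_eta (z : J0) : mk (z.1 0) (z.1 1) (z.1 2) (z.2 0) (z.2 1) (z.2 2) = z := by
  ext i <;> fin_cases i <;> rfl

section partials

variable {F : J0 → ℝ} (t x y u v w : ℝ)

theorem hasDerivAt_comp_mk {F : J0 → ℝ} (hF : ContDiff ℝ ∞ F) {c : ℝ → J0} {c' : J0} {s : ℝ}
    (hc : HasDerivAt c c' s) : HasDerivAt (fun r => F (c r)) (pd c' F (c s)) s :=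
  (hF.differentiable (by simp) (c s)).hasFDerivAt.comp_hasDerivAt s hc

theorem hasDerivAt_mk_t (hF : ContDiff ℝ ∞ F) :
    HasDerivAt (fun s => F (mk s x y u v w)) (pd et F (mk t x y u v w)) t :=
  hasDerivAt_comp_mk hF (hasDerivAt_mk (hasDerivAt_id t) (hasDerivAt_const _ _)
    (hasDerivAt_const _ _) (hasDerivAt_const _ _) (hasDerivAt_const _ _) (hasDerivAt_const _ _))

theorem hasDerivAt_mk_x (hF : ContDiff ℝ ∞ F) :
    HasDerivAt (fun s => F (mk t s y u v w)) (pd ex F (mk t x y u v w)) x :=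
  hasDerivAt_comp_mk hF (hasDerivAt_mk (hasDerivAt_const _ _) (hasDerivAt_id x)
    (hasDerivAt_const _ _) (hasDerivAt_const _ _) (hasDerivAt_const _ _) (hasDerivAt_const _ _))

theorem hasDerivAt_mk_y (hF : ContDiff ℝ ∞ F) :
    HasDerivAt (fun s => F (mk t x s u v w)) (pd ey F (mk t x y u v w)) y :=
  hasDerivAt_comp_mk hF (hasDerivAt_mk (hasDerivAt_const _ _) (hasDerivAt_const _ _)
    (hasDerivAt_id y) (hasDerivAt_const _ _) (hasDerivAt_const _ _) (hasDerivAt_const _ _))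

theorem hasDerivAt_mk_u (hF : ContDiff ℝ ∞ F) :
    HasDerivAt (fun s => F (mk t x y s v w)) (pd eu F (mk t x y u v w)) u :=
  hasDerivAt_comp_mk hF (hasDerivAt_mk (hasDerivAt_const _ _) (hasDerivAt_const _ _)
    (hasDerivAt_const _ _) (hasDerivAt_id u) (hasDerivAt_const _ _) (hasDerivAt_const _ _))

theorem hasDerivAt_mk_v (hF : ContDiff ℝ ∞ F) :
    HasDerivAt (fun s => F (mk t x y u s w)) (pd ev F (mk t x y u v w)) v :=
  hasDerivAt_comp_mk hF (hasDerivAt_mk (hasDerivAt_const _ _) (hasDerivAt_const _ _)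
    (hasDerivAt_const _ _) (hasDerivAt_const _ _) (hasDerivAt_id v) (hasDerivAt_const _ _))

theorem hasDerivAt_mk_w (hF : ContDiff ℝ ∞ F) :
    HasDerivAt (fun s => F (mk t x y u v s)) (pd ew F (mk t x y u v w)) w :=
  hasDerivAt_comp_mk hF (hasDerivAt_mk (hasDerivAt_const _ _) (hasDerivAt_const _ _)
    (hasDerivAt_const _ _) (hasDerivAt_const _ _) (hasDerivAt_const _ _) (hasDerivAt_id w))

end partials

/-! ### Integration in one variable -/

theorem sub_eq_of_hasDerivAt {f g f' : ℝ → ℝ} (hf : ∀ s, HasDerivAt f (f' s) s)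
    (hg : ∀ s, HasDerivAt g (f' s) s) (a b : ℝ) : f a - f b = g a - g b := by
  have h : ∀ s, HasDerivAt (f - g) 0 s := fun s => by simpa using (hf s).sub (hg s)
  have := is_const_of_deriv_eq_zero (fun s => (h s).differentiableAt) (fun s => (h s).deriv) a b
  simp only [Pi.sub_apply] at this
  linarith

theorem eq_of_hasDerivAt_zero {f f' : ℝ → ℝ} (hf : ∀ s, HasDerivAt f (f' s) s)
    (h : ∀ s, f' s = 0) (a b : ℝ) : f a = f b :=
  is_const_of_deriv_eq_zero (fun s => (hf s).differentiableAt)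
    (fun s => (hf s).deriv.trans (h s)) a b

theorem quadratic_of_hasDerivAt {f f' : ℝ → ℝ} {c d : ℝ} (hf : ∀ s, HasDerivAt f (f' s) s)
    (h : ∀ s, f' s = c + d * s) (a : ℝ) : f a = f 0 + c * a + d / 2 * a ^ 2 := by
  have hg : ∀ s, HasDerivAt (fun s => c * s + d / 2 * s ^ 2) (f' s) s := by
    intro s
    rw [h]
    refine (((hasDerivAt_id s).const_mul c).add ((hasDerivAt_pow 2 s).const_mul (d / 2))).congr_deriv
      ?_
    simp
    ring
  have := sub_eq_of_hasDerivAt hf hg a 0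
  simp at this
  linarith

theorem eq_mk_of_vertical {F : J0 → ℝ} (hF : ContDiff ℝ ∞ F) (hu : ∀ z, pd eu F z = 0)
    (hv : ∀ z, pd ev F z = 0) (hw : ∀ z, pd ew F z = 0) (t x y u v w u' v' w' : ℝ) :
    F (mk t x y u v w) = F (mk t x y u' v' w') := by
  rw [eq_of_hasDerivAt_zero (fun s => hasDerivAt_mk_u t x y s v w hF) (fun _ => hu _) u u',
    eq_of_hasDerivAt_zero (fun s => hasDerivAt_mk_v t x y u' s w hF) (fun _ => hv _) v v',
    eq_of_hasDerivAt_zero (fun s => hasDerivAt_mk_w t x y u' v' s hF) (fun _ => hw _) w w']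

/-- A smooth function of the variables, restricted to a line on which only `t` varies. -/
def alongT {F : J0 → ℝ} (hF : ContDiff ℝ ∞ F) (x y u v w : ℝ) : C :=
  ⟨fun t => F (mk t x y u v w), hF.comp (contDiff_mk (a := fun z : J0 => z.1 0)
    (b := fun _ => x) (c := fun _ => y) (d := fun _ => u) (e := fun _ => v) (f := fun _ => w)
    (by fun_prop) contDiff_const contDiff_const contDiff_const contDiff_const contDiff_const
    |>.comp (f := fun t : ℝ => ((fun _ => t, 0) : J0)) (by fun_prop))⟩

theorem D_apply_of_hasDerivAt {f : C} {t f' : ℝ} (h : HasDerivAt f.1 f' t) : (D f).1 t = f' :=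
  (f.hasDerivAt t).unique h

section integration

variable {ε₁ ε₂ δ₁ δ₂ : ℝ} {V : VF}

theorem exists_xi (hε₁ : ε₁ = 1 ∨ ε₁ = -1) (hV : IsSymmetry ε₁ ε₂ δ₁ δ₂ V) :
    ∃ τ α β : C, ∀ t x y u v w, xi V 0 (mk t x y u v w) = τ.1 t ∧
      xi V 1 (mk t x y u v w) = (D τ).1 t / 2 * x + α.1 t ∧
      xi V 2 (mk t x y u v w) = (D τ).1 t / 2 * y + β.1 t := by
  have c := contDiff_xi V
  obtain ⟨x0, y0, xy⟩ := pd_xi_horizontal hε₁ hV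
  have ver := pd_xi_vertical hε₁ hV
  have vert : ∀ k t x y u v w u' v' w', xi V k (mk t x y u v w) = xi V k (mk t x y u' v' w') :=
    fun k => eq_mk_of_vertical (c k) (congrFun (ver k).1) (congrFun (ver k).2.1)
      (congrFun (ver k).2.2)
  have f := pd_eta_first hε₁ hV
  have hτ : ∀ t x y u v w, xi V 0 (mk t x y u v w) = (alongT (c 0) 0 0 0 0 0).1 t := by
    intro t x y u v w
    rw [vert 0 t x y u v w 0 0 0,
      eq_of_hasDerivAt_zero (fun s => hasDerivAt_mk_x t s y 0 0 0 (c 0)) (fun _ => congrFun x0 _)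
        x 0,
      eq_of_hasDerivAt_zero (fun s => hasDerivAt_mk_y t 0 s 0 0 0 (c 0)) (fun _ => congrFun y0 _)
        y 0]
    rfl
  have ht : ∀ t x y u v w, pd et (xi V 0) (mk t x y u v w)
      = (D (alongT (c 0) 0 0 0 0 0)).1 t := by
    intro t x y u v w
    refine (hasDerivAt_mk_t t x y u v w (c 0)).unique ?_
    simp only [hτ]
    exact C.hasDerivAt _ _
  -- The equation `u ∂_y ξ¹ = 0` is useful only where `u ≠ 0`; as `∂_y ξ¹` does not depend on `u, v,
  -- φ`, it may be evaluated at `u = 1`.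
  have y1 : ∀ z, pd ey (xi V 1) z = 0 := by
    have cy := contDiff_pd (c 1) ey
    have h : ∀ v, pd v (xi V 1) = (fun _ => 0) → ∀ z, pd v (pd ey (xi V 1)) z = 0 := by
      intro v hv z
      rw [pd_comm (c 1), hv, pd_zero]
    intro z
    rw [← mk_eta z, eq_mk_of_vertical cy (h _ (ver 1).1) (h _ (ver 1).2.1) (h _ (ver 1).2.2)
      _ _ _ _ _ _ 1 0 0]
    simpa [mk] using (pd_eta_second hε₁ hV (mk (z.1 0) (z.1 1) (z.1 2) 1 0 0)).2.2.2.2.2.1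
  have x2 : ∀ z, pd ex (xi V 2) z = 0 := fun z => by simpa [y1 z] using xy z
  refine ⟨alongT (c 0) 0 0 0 0 0, alongT (c 1) 0 0 0 0 0, alongT (c 2) 0 0 0 0 0,
    fun t x y u v w => ⟨hτ t x y u v w, ?_, ?_⟩⟩
  · rw [vert 1 t x y u v w 0 0 0,
      eq_of_hasDerivAt_zero (fun s => hasDerivAt_mk_y t x s 0 0 0 (c 1)) (fun _ => y1 _) y 0,
      quadratic_of_hasDerivAt (fun s => hasDerivAt_mk_x t s 0 0 0 0 (c 1))
        (c := (D (alongT (c 0) 0 0 0 0 0)).1 t / 2) (d := 0) (fun s => by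
          rw [← ht t s 0 0 0 0, (f _).2.2.2.2.2.2.1]; ring) x]
    simp only [alongT]
    ring
  · rw [vert 2 t x y u v w 0 0 0,
      eq_of_hasDerivAt_zero (fun s => hasDerivAt_mk_x t s y 0 0 0 (c 2)) (fun _ => x2 _) x 0,
      quadratic_of_hasDerivAt (fun s => hasDerivAt_mk_y t 0 s 0 0 0 (c 2))
        (c := (D (alongT (c 0) 0 0 0 0 0)).1 t / 2) (d := 0) (fun s => by
          rw [← ht t 0 s 0 0 0, (f _).2.2.2.2.2.2.1, (f _).2.2.2.2.2.2.2]; ring) y]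
    simp only [alongT]
    ring

end integration

/-! ### Partial derivatives of the phase and the shift -/

theorem hasDerivAt_phase_t (ε₁ : ℝ) (τ α β μ : C) (t x y : ℝ) :
    HasDerivAt (fun s => phase ε₁ τ α β μ s x y)
      (phase ε₁ (D τ) (D α) (D β) (D μ) t x y) t :=
  (((μ.hasDerivAt t).sub (((D (D τ)).hasDerivAt t).const_mul _)).sub
    (((D α).hasDerivAt t).const_mul _)).sub ((((D β).hasDerivAt t).const_mul ε₁).const_mul _)

theorem hasDerivAt_phase_y (ε₁ : ℝ) (τ α β μ : C) (t x y : ℝ) :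
    HasDerivAt (fun s => phase ε₁ τ α β μ t x s)
      (-(ε₁ * (D (D τ)).1 t) / 4 * y - ε₁ * (D β).1 t / 2) y := by
  refine ((((((((hasDerivAt_pow 2 y).const_mul ε₁).const_add (x ^ 2)).div_const 8).mul_const
    ((D (D τ)).1 t)).const_sub (μ.1 t)).sub_const (x / 2 * (D α).1 t)).sub
    (((hasDerivAt_id y).div_const 2).mul_const (ε₁ * (D β).1 t))).congr_deriv ?_
  simp
  ring

theorem hasDerivAt_shift_y (ε₁ δ₁ : ℝ) (τ α β μ γ δ : C) (t x y : ℝ) :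
    HasDerivAt (fun s => shift ε₁ δ₁ τ α β μ γ δ t x s)
      (phase ε₁ (D τ) (D α) (D β) (D μ) t x y) y := by
  have l := hasDerivAt_id y
  refine (((((((l.const_mul (x ^ 2)).add ((hasDerivAt_pow 3 y).const_mul (ε₁ / 3))).const_mul
    ((D (D (D τ))).1 t / 8)).neg.sub (((l.const_mul x).div_const 2).mul_const
      ((D (D α)).1 t))).add (((hasDerivAt_pow 2 y).const_sub (δ₁ * x ^ 2)).const_mul
      (ε₁ * (D (D β)).1 t / 4))).add (l.mul_const ((D μ).1 t))).add_const (x * γ.1 t)).add_const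
    (δ.1 t) |>.congr_deriv ?_
  simp [phase]
  ring

theorem quadratic_of_second_deriv {f f' f'' : ℝ → ℝ} {d : ℝ} (hf : ∀ s, HasDerivAt f (f' s) s)
    (hf' : ∀ s, HasDerivAt f' (f'' s) s) (h : ∀ s, f'' s = d) (a : ℝ) :
    f a = f 0 + f' 0 * a + d / 2 * a ^ 2 :=
  quadratic_of_hasDerivAt hf (fun s => by
    rw [quadratic_of_hasDerivAt hf' (c := d) (d := 0) (fun s => by rw [h]; ring) s]; ring) a

section integration

variable {ε₁ ε₂ δ₁ δ₂ : ℝ} {V : VF}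

/-- The coefficients of `∂_u` and `∂_v` of a symmetry, and the first derivatives with respect to `y`
and `φ` of its coefficient of `∂_φ`. -/
theorem exists_eta (hε₁ : ε₁ = 1 ∨ ε₁ = -1) (hε₂ : ε₂ = 1 ∨ ε₂ = -1)
    (hV : IsSymmetry ε₁ ε₂ δ₁ δ₂ V) {τ α β : C}
    (hξ : ∀ t x y u v w, xi V 0 (mk t x y u v w) = τ.1 t ∧
      xi V 1 (mk t x y u v w) = (D τ).1 t / 2 * x + α.1 t ∧
      xi V 2 (mk t x y u v w) = (D τ).1 t / 2 * y + β.1 t) :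
    ∃ μ : C, ∀ t x y u v w,
      eta V 0 (mk t x y u v w) = -((D τ).1 t / 2 * u) + phase ε₁ τ α β μ t x y * v ∧
      eta V 1 (mk t x y u v w) = -((D τ).1 t / 2 * v) - phase ε₁ τ α β μ t x y * u ∧
      pd ew (eta V 2) (mk t x y u v w) = -((D τ).1 t / 2) ∧
      pd ey (eta V 2) (mk t x y u v w) = phase ε₁ (D τ) (D α) (D β) (D μ) t x y := by
  have c := contDiff_xi V
  have d := contDiff_eta V
  have f := pd_eta_first hε₁ hV
  have g := pd_eta_second hε₁ hV
  have x1 : ∀ t x y u v w, pd ex (xi V 1) (mk t x y u v w) = (D τ).1 t / 2 := by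
    intro t x y u v w
    refine (hasDerivAt_mk_x t x y u v w (c 1)).unique ?_
    simp only [(hξ _ _ _ _ _ _).2.1]
    simpa using ((hasDerivAt_id x).const_mul ((D τ).1 t / 2)).add_const (α.1 t)
  have y1 : ∀ t x y u v w, pd ey (xi V 1) (mk t x y u v w) = 0 := by
    intro t x y u v w
    refine (hasDerivAt_mk_y t x y u v w (c 1)).unique ?_
    simp only [(hξ _ _ _ _ _ _).2.1]
    exact hasDerivAt_const _ _
  have x2 : ∀ t x y u v w, pd ex (xi V 2) (mk t x y u v w) = 0 := by
    intro t x y u v w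
    refine (hasDerivAt_mk_x t x y u v w (c 2)).unique ?_
    simp only [(hξ _ _ _ _ _ _).2.2]
    exact hasDerivAt_const _ _
  have y2 : ∀ t x y u v w, pd ey (xi V 2) (mk t x y u v w) = (D τ).1 t / 2 := fun t x y u v w =>
    (f _).2.2.2.2.2.2.2.trans (x1 t x y u v w)
  have t1 : ∀ t x y u v w, pd et (xi V 1) (mk t x y u v w)
      = (D (D τ)).1 t / 2 * x + (D α).1 t := by
    intro t x y u v w
    refine (hasDerivAt_mk_t t x y u v w (c 1)).unique ?_
    simp only [(hξ _ _ _ _ _ _).2.1]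
    exact ((((D τ).hasDerivAt t).div_const 2).mul_const x).add (α.hasDerivAt t)
  have t2 : ∀ t x y u v w, pd et (xi V 2) (mk t x y u v w)
      = (D (D τ)).1 t / 2 * y + (D β).1 t := by
    intro t x y u v w
    refine (hasDerivAt_mk_t t x y u v w (c 2)).unique ?_
    simp only [(hξ _ _ _ _ _ _).2.2]
    exact ((((D τ).hasDerivAt t).div_const 2).mul_const y).add (β.hasDerivAt t)
  have xx1 : ∀ t x y u v w, pd ex (pd ex (xi V 1)) (mk t x y u v w) = 0 := by
    intro t x y u v w
    refine (hasDerivAt_mk_x t x y u v w (contDiff_pd (c 1) ex)).unique ?_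
    simp only [x1]
    exact hasDerivAt_const _ _
  have yy1 : ∀ t x y u v w, pd ey (pd ey (xi V 1)) (mk t x y u v w) = 0 := by
    intro t x y u v w
    refine (hasDerivAt_mk_y t x y u v w (contDiff_pd (c 1) ey)).unique ?_
    simp only [y1]
    exact hasDerivAt_const _ _
  have xx2 : ∀ t x y u v w, pd ex (pd ex (xi V 2)) (mk t x y u v w) = 0 := by
    intro t x y u v w
    refine (hasDerivAt_mk_x t x y u v w (contDiff_pd (c 2) ex)).unique ?_
    simp only [x2]
    exact hasDerivAt_const _ _
  have yy2 : ∀ t x y u v w, pd ey (pd ey (xi V 2)) (mk t x y u v w) = 0 := by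
    intro t x y u v w
    refine (hasDerivAt_mk_y t x y u v w (contDiff_pd (c 2) ey)).unique ?_
    simp only [y2]
    exact hasDerivAt_const _ _
  have w0 : pd ew (eta V 0) = fun _ => 0 := funext fun z => (f z).2.1
  have u2 : pd eu (eta V 2) = fun _ => 0 := funext fun z => (f z).2.2.2.1
  have v2 : pd ev (eta V 2) = fun _ => 0 := funext fun z => (f z).2.2.2.2.1
  have dA := contDiff_pd (d 0) eu
  have dB := contDiff_pd (d 0) ev
  -- The diagonal coefficient of `η⁰` is a function of `t` alone: its `u, v, φ`-derivatives vanish,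
  -- and its `x`- and `y`-derivatives are given by second derivatives of the affine functions `ξ¹,
  -- ξ²`.
  have hA : ∀ t x y u v w, pd eu (eta V 0) (mk t x y u v w) = pd eu (eta V 0) (mk t 0 0 0 0 0) := by
    intro t x y u v w
    rw [eq_mk_of_vertical dA (fun z => (g z).1.1)
        (fun z => by rw [pd_comm (d 0)]; exact (g z).1.2.1)
        (fun z => by rw [pd_comm (d 0), w0, pd_zero]) t x y u v w 0 0 0,
      eq_of_hasDerivAt_zero (fun s => hasDerivAt_mk_x t s y 0 0 0 dA) (fun s => ?_) x 0,
      eq_of_hasDerivAt_zero (fun s => hasDerivAt_mk_y t 0 s 0 0 0 dA) (fun s => ?_) y 0]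
    · have := (g (mk t 0 s 0 0 0)).2.2.1
      rw [xx2, yy2] at this
      rcases hε₁ with rfl | rfl <;> linarith
    · have := (g (mk t s y 0 0 0)).2.1
      rw [xx1, yy1] at this
      linarith
  -- The `x`- and `y`-derivatives of the off-diagonal coefficient are `-ξ¹_t / 2` and `-ε₁ ξ²_t /
  -- 2`, affine in `x` and `y`; integration yields `phase`, with `μ` as the value at the origin.
  have hB : ∀ t x y u v w, pd ev (eta V 0) (mk t x y u v w)
      = phase ε₁ τ α β (alongT dB 0 0 0 0 0) t x y := by
    intro t x y u v w
    rw [eq_mk_of_vertical dB (fun z => (g z).1.2.1) (fun z => (g z).1.2.2)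
        (fun z => by rw [pd_comm (d 0), w0, pd_zero]) t x y u v w 0 0 0,
      quadratic_of_hasDerivAt (fun s => hasDerivAt_mk_x t s y 0 0 0 dB)
        (c := -(D α).1 t / 2) (d := -(D (D τ)).1 t / 4) (fun s => ?_) x,
      quadratic_of_hasDerivAt (fun s => hasDerivAt_mk_y t 0 s 0 0 0 dB)
        (c := -(ε₁ * (D β).1 t) / 2) (d := -(ε₁ * (D (D τ)).1 t) / 4) (fun s => ?_) y]
    · simp only [alongT, phase]
      ring
    · have := (g (mk t 0 s 0 0 0)).2.2.2.2.1
      rw [t2] at this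
      rcases hε₁ with rfl | rfl <;> linarith
    · have := (g (mk t s y 0 0 0)).2.2.2.1
      rw [t1] at this
      linarith
  -- There is no term free of `u, v`: the equation from `φ_y`, taken at `u = 0`, gives `η⁰` there as
  -- `v` times its `v`-derivative.
  have h0 : ∀ t x y u v w, eta V 0 (mk t x y u v w) = pd eu (eta V 0) (mk t 0 0 0 0 0) * u
      + phase ε₁ τ α β (alongT dB 0 0 0 0 0) t x y * v := by
    intro t x y u v w
    rw [quadratic_of_hasDerivAt (fun s => hasDerivAt_mk_u t x y s v w (d 0))
      (c := pd eu (eta V 0) (mk t 0 0 0 0 0)) (d := 0) (fun s => by rw [hA]; ring) u,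
      (g (mk t x y 0 v w)).2.2.2.2.2.2.1, hB]
    simp [mk]
    ring
  have hF : ∀ t x y u v w, pd ew (eta V 2) (mk t x y u v w) = -((D τ).1 t / 2) := by
    intro t x y u v w
    -- Comparing this with `h0` leaves `u (ξ¹_x + ∂_φ η²) = 0`, so `u = 1` is used; `∂_φ η²` does
    -- not depend on `u`.
    have e := (g (mk t x y 1 v w)).2.2.2.2.2.2.1
    rw [h0, hB, hA t x y 1 v w, x1] at e
    simp [mk] at e
    rw [eq_of_hasDerivAt_zero (fun s => hasDerivAt_mk_u t x y s v w (contDiff_pd (d 2) ew))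
      (fun s => by rw [pd_comm (d 2), u2, pd_zero]) u 1]
    simp only [mk]
    linarith
  have h1 : ∀ t x y u v w, eta V 1 (mk t x y u v w) = pd eu (eta V 0) (mk t 0 0 0 0 0) * v
      - phase ε₁ τ α β (alongT dB 0 0 0 0 0) t x y * u := by
    intro t x y u v w
    rw [(g (mk t x y u v w)).2.2.2.2.2.2.2.1, hA, x1, hF, hB]
    simp [mk]
    ring
  -- The equation without derivatives, restricted to `v = 0` and `u = r`, has only a linear and a
  -- cubic term in `r`, because `∂_y η²` does not depend on `r`.
  have key : ∀ t x y r w, pd ey (eta V 2) (mk t x y r 0 w) = pd ey (eta V 2) (mk t x y 1 0 w) ∧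
      r * phase ε₁ (D τ) (D α) (D β) (D (alongT dB 0 0 0 0 0)) t x y
        - (2 * pd eu (eta V 0) (mk t 0 0 0 0 0) + (D τ).1 t) * ε₂ * r ^ 3
        - r * pd ey (eta V 2) (mk t x y 1 0 w) = 0 := by
    intro t x y r w
    have hr : pd ey (eta V 2) (mk t x y r 0 w) = pd ey (eta V 2) (mk t x y 1 0 w) :=
      eq_of_hasDerivAt_zero (fun s => hasDerivAt_mk_u t x y s 0 w (contDiff_pd (d 2) ey))
        (fun s => by rw [pd_comm (d 2), u2, pd_zero]) r 1
    refine ⟨hr, ?_⟩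
    have e := (g (mk t x y r 0 w)).2.2.2.2.2.2.2.2.1
    have ht : pd et (eta V 1) (mk t x y r 0 w)
        = -(phase ε₁ (D τ) (D α) (D β) (D (alongT dB 0 0 0 0 0)) t x y * r) := by
      refine (hasDerivAt_mk_t t x y r 0 w (d 1)).unique ?_
      simp only [h1, mul_zero, zero_sub]
      exact ((hasDerivAt_phase_t ε₁ τ α β _ t x y).mul_const r).neg
    have hx : ∀ x, pd ex (eta V 0) (mk t x y r 0 w) = 0 := by
      intro x
      refine (hasDerivAt_mk_x t x y r 0 w (d 0)).unique ?_
      simp only [h0, mul_zero, add_zero]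
      exact hasDerivAt_const _ _
    have hy : ∀ y, pd ey (eta V 0) (mk t x y r 0 w) = 0 := by
      intro y
      refine (hasDerivAt_mk_y t x y r 0 w (d 0)).unique ?_
      simp only [h0, mul_zero, add_zero]
      exact hasDerivAt_const _ _
    have hxx : pd ex (pd ex (eta V 0)) (mk t x y r 0 w) = 0 := by
      refine (hasDerivAt_mk_x t x y r 0 w (contDiff_pd (d 0) ex)).unique ?_
      simp only [hx]
      exact hasDerivAt_const _ _
    have hyy : pd ey (pd ey (eta V 0)) (mk t x y r 0 w) = 0 := by
      refine (hasDerivAt_mk_y t x y r 0 w (contDiff_pd (d 0) ey)).unique ?_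
      simp only [hy]
      exact hasDerivAt_const _ _
    rw [ht, hxx, hyy, hr, hA t x y r 0 w, x1, h0, h1] at e
    simp [mk] at e
    simp only [mk]
    linarith
  have ha : ∀ t, pd eu (eta V 0) (mk t 0 0 0 0 0) = -((D τ).1 t / 2) := by
    intro t
    -- Two nonzero values of `r` separate the cubic term from the linear one. Since `ε₂ ≠ 0`, its
    -- coefficient `2 ∂_u η⁰ + τ'` vanishes.
    have k1 := (key t 0 0 1 0).2
    have k2 := (key t 0 0 2 0).2
    rcases hε₂ with rfl | rfl <;> linarith
  refine ⟨alongT dB 0 0 0 0 0, fun t x y u v w => ⟨?_, ?_, hF t x y u v w, ?_⟩⟩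
  · rw [h0, ha]
    ring
  · rw [h1, ha]
    ring
  · have k := (key t x y 1 w).2
    rw [ha] at k
    rw [eq_of_hasDerivAt_zero (fun s => hasDerivAt_mk_v t x y u s w (contDiff_pd (d 2) ey))
        (fun s => by rw [pd_comm (d 2), v2, pd_zero]) v 0, (key t x y u w).1]
    linarith

/-- Every symmetry is a general element whose `τ` satisfies the restriction. -/
theorem exists_G_of_isSymmetry (hε₁ : ε₁ = 1 ∨ ε₁ = -1) (hε₂ : ε₂ = 1 ∨ ε₂ = -1)
    (hV : IsSymmetry ε₁ ε₂ δ₁ δ₂ V) :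
    ∃ τ α β μ γ δ : C, (ε₁ + δ₁) • D (D (D τ)) = 0 ∧ V = G ε₁ δ₁ τ α β μ γ δ := by
  obtain ⟨τ, α, β, hξ⟩ := exists_xi hε₁ hV
  obtain ⟨μ, hη⟩ := exists_eta hε₁ hε₂ hV hξ
  have d := contDiff_eta V 2
  have f := pd_eta_first hε₁ hV
  let δ : C := alongT d 0 0 0 0 0
  -- At `x = 1, y = 0` the function `shift` equals `ε₁ δ₁ β'' / 4 + γ + δ`, which determines `γ`.
  let γ : C := alongT d 1 0 0 0 0 - δ - (ε₁ * δ₁ / 4) • D (D β)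
  have hyy : ∀ t x y, pd ey (pd ey (eta V 2)) (mk t x y 0 0 0)
      = -(ε₁ * (D (D (D τ))).1 t) / 4 * y - ε₁ * (D (D β)).1 t / 2 := by
    intro t x y
    refine (hasDerivAt_mk_y t x y 0 0 0 (contDiff_pd d ey)).unique ?_
    simp only [(hη _ _ _ _ _ _).2.2.2]
    exact hasDerivAt_phase_y ε₁ (D τ) (D α) (D β) (D μ) t x y
  have hxx : ∀ t x y, pd ex (pd ex (eta V 2)) (mk t x y 0 0 0)
      = δ₁ * ε₁ * ((D (D (D τ))).1 t / 4 * y + (D (D β)).1 t / 2) := by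
    intro t x y
    -- At `u = v = 0` the right-hand side with `δ₂` drops out, so `η²_xx = -δ₁ η²_yy`.
    have h := (pd_eta_second hε₁ hV (mk t x y 0 0 0)).2.2.2.2.2.2.2.2.2
    rw [hyy] at h
    simp [mk] at h
    simp only [mk]
    linarith
  have quad : ∀ t y x, eta V 2 (mk t x y 0 0 0) = eta V 2 (mk t 0 y 0 0 0)
      + pd ex (eta V 2) (mk t 0 y 0 0 0) * x
      + δ₁ * ε₁ * ((D (D (D τ))).1 t / 4 * y + (D (D β)).1 t / 2) / 2 * x ^ 2 := fun t y =>
    quadratic_of_second_deriv (fun s => hasDerivAt_mk_x t s y 0 0 0 d)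
      (fun s => hasDerivAt_mk_x t s y 0 0 0 (contDiff_pd d ex)) fun s => hxx t s y
  have hx : ∀ t x, eta V 2 (mk t x 0 0 0 0) = shift ε₁ δ₁ τ α β μ γ δ t x 0 := by
    intro t x
    have q := quad t 0 1
    rw [quad t 0 x]
    simp only [γ, δ, shift, alongT, C.sub_apply, C.smul_apply]
    rw [q]
    ring
  have hy : ∀ t x y, eta V 2 (mk t x y 0 0 0) = shift ε₁ δ₁ τ α β μ γ δ t x y := by
    intro t x y
    have h := sub_eq_of_hasDerivAt
      (fun s => (hasDerivAt_mk_y t x s 0 0 0 d).congr_deriv (hη t x s 0 0 0).2.2.2)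
      (hasDerivAt_shift_y ε₁ δ₁ τ α β μ γ δ t x) y 0
    linarith [hx t x]
  have hz : ∀ t x y u v w, eta V 2 (mk t x y u v w)
      = -((D τ).1 t / 2 * w) + shift ε₁ δ₁ τ α β μ γ δ t x y := by
    intro t x y u v w
    rw [eq_of_hasDerivAt_zero (fun s => hasDerivAt_mk_u t x y s v w d)
        (fun s => (f _).2.2.2.1) u 0,
      eq_of_hasDerivAt_zero (fun s => hasDerivAt_mk_v t x y 0 s w d)
        (fun s => (f _).2.2.2.2.1) v 0,
      quadratic_of_hasDerivAt (fun s => hasDerivAt_mk_w t x y 0 0 s d) (c := -((D τ).1 t / 2))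
        (d := 0) (fun s => by rw [(hη _ _ _ _ _ _).2.2.1]; ring) w, hy]
    ring
  refine ⟨τ, α, β, μ, γ, δ, ?_, ?_⟩
  · ext t
    -- `η²_xx` is now known twice, from `shift` and from `hxx`. Adding the values at `x = 1` and `x
    -- = -1` removes the linear term; the `β''`-terms agree, and what remains at `y = 1` is the
    -- restriction on `τ`.
    have q1 := quad t 1 1
    have q2 := quad t 1 (-1)
    simp only [hy, shift] at q1 q2
    simp only [C.smul_apply, C.zero_apply]
    rcases hε₁ with rfl | rfl <;> linarith
  · ext1; funext z
    rw [G_apply hε₁, ← mk_eta z]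
    have e : V.1 (mk (z.1 0) (z.1 1) (z.1 2) (z.2 0) (z.2 1) (z.2 2)) =
        mk (xi V 0 (mk (z.1 0) (z.1 1) (z.1 2) (z.2 0) (z.2 1) (z.2 2)))
          (xi V 1 (mk (z.1 0) (z.1 1) (z.1 2) (z.2 0) (z.2 1) (z.2 2)))
          (xi V 2 (mk (z.1 0) (z.1 1) (z.1 2) (z.2 0) (z.2 1) (z.2 2)))
          (eta V 0 (mk (z.1 0) (z.1 1) (z.1 2) (z.2 0) (z.2 1) (z.2 2)))
          (eta V 1 (mk (z.1 0) (z.1 1) (z.1 2) (z.2 0) (z.2 1) (z.2 2)))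
          (eta V 2 (mk (z.1 0) (z.1 1) (z.1 2) (z.2 0) (z.2 1) (z.2 2))) := (mk_eta _).symm
    rw [e, (hξ _ _ _ _ _ _).1, (hξ _ _ _ _ _ _).2.1, (hξ _ _ _ _ _ _).2.2,
      (hη _ _ _ _ _ _).1, (hη _ _ _ _ _ _).2.1, hz]
    rfl

end integration

/-! ### The symmetry algebra -/

/-- By Leibniz, the terms with `τ'' τ'''`-type products are absent, and `(τ₁τ₂' - τ₁'τ₂)''' =
τ₁τ₂'''' + 2τ₁'τ₂''' - 2τ₁'''τ₂' - τ₁''''τ₂`; each term contains a derivative of order at least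
three. -/
theorem D_D_D_lie {c : ℝ} {τ τ' : C} (hτ : c • D (D (D τ)) = 0) (hτ' : c • D (D (D τ')) = 0) :
    c • D (D (D (τ * D τ' - D τ * τ'))) = 0 := by
  have h1 : c • D (D (D (D τ))) = 0 := by rw [← D.map_smul, hτ, map_zero]
  have h2 : c • D (D (D (D τ'))) = 0 := by rw [← D.map_smul, hτ', map_zero]
  ext t
  have e1 := congrArg (fun f : C => f.1 t) hτ
  have e2 := congrArg (fun f : C => f.1 t) hτ'
  have e3 := congrArg (fun f : C => f.1 t) h1
  have e4 := congrArg (fun f : C => f.1 t) h2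
  simp only [C.smul_apply, C.zero_apply] at e1 e2 e3 e4
  simp only [D_mul, map_add, map_sub, C.add_apply, C.sub_apply, C.mul_apply, C.smul_apply,
    C.zero_apply]
  linear_combination τ.1 t * e4 + 2 * (D τ).1 t * e2 - 2 * (D τ').1 t * e1 - τ'.1 t * e3

/-- The Lie algebra of the general elements whose `τ` satisfies the restriction. -/
def symmetryAlgebra {ε₁ : ℝ} (hε₁ : ε₁ = 1 ∨ ε₁ = -1) (δ₁ : ℝ) : LieSubalgebra ℝ VF where
  carrier := {V | ∃ τ α β μ γ δ : C, (ε₁ + δ₁) • D (D (D τ)) = 0 ∧ V = G ε₁ δ₁ τ α β μ γ δ}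
  add_mem' := by
    rintro _ _ ⟨τ, α, β, μ, γ, δ, h, rfl⟩ ⟨τ', α', β', μ', γ', δ', h', rfl⟩
    exact ⟨_, _, _, _, _, _, by rw [map_add, map_add, map_add, smul_add, h, h', add_zero],
      G_add hε₁ δ₁ τ α β μ γ δ τ' α' β' μ' γ' δ'⟩
  zero_mem' := ⟨0, 0, 0, 0, 0, 0, by simp, (G_zero ε₁ δ₁).symm⟩
  smul_mem' := by
    rintro c _ ⟨τ, α, β, μ, γ, δ, h, rfl⟩
    exact ⟨_, _, _, _, _, _, by rw [D.map_smul, D.map_smul, D.map_smul, smul_comm, h, smul_zero],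
      G_smul hε₁ δ₁ c τ α β μ γ δ⟩
  lie_mem' := by
    rintro _ _ ⟨τ, α, β, μ, γ, δ, h, rfl⟩ ⟨τ', α', β', μ', γ', δ', h', rfl⟩
    exact ⟨_, _, _, _, _, _, D_D_D_lie h h', lie_G hε₁ α β μ γ δ α' β' μ' γ' δ' h h'⟩

theorem eq_quadratic_of_D_D_D_eq_zero {τ : C} (h : D (D (D τ)) = 0) :
    ∃ τ₀ τ₁ τ₂ : ℝ, ∀ t : ℝ, τ.1 t = τ₂ * t ^ 2 + τ₁ * t + τ₀ := by
  have h2 : ∀ s, (D (D τ)).1 s = (D (D τ)).1 0 := fun s =>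
    eq_of_hasDerivAt_zero (D (D τ)).hasDerivAt (fun s => by rw [h]; rfl) s 0
  refine ⟨τ.1 0, (D τ).1 0, (D (D τ)).1 0 / 2, fun t => ?_⟩
  rw [quadratic_of_second_deriv τ.hasDerivAt (D τ).hasDerivAt h2 t]
  ring

theorem D_D_D_eq_zero_of_quadratic {τ : C} {a b c : ℝ} (h : ∀ t, τ.1 t = a * t ^ 2 + b * t + c) :
    D (D (D τ)) = 0 := by
  have h1 : ∀ t, (D τ).1 t = 2 * a * t + b := by
    intro t
    apply D_apply_of_hasDerivAt
    rw [funext h]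
    refine ((((hasDerivAt_pow 2 t).const_mul a).add ((hasDerivAt_id t).const_mul b)).add_const
      c).congr_deriv ?_
    simp
    ring
  have h2 : ∀ t, (D (D τ)).1 t = 2 * a := by
    intro t
    apply D_apply_of_hasDerivAt
    rw [funext h1]
    simpa using ((hasDerivAt_id t).const_mul (2 * a)).add_const b
  ext t
  apply D_apply_of_hasDerivAt
  rw [funext h2]
  exact hasDerivAt_const _ _

/-! ### The Virasoro algebra has no solvable ideals -/

/-- The function `t`. -/
def time : C := ⟨fun t => t, (contDiff_id : ContDiff ℝ ∞ fun t : ℝ => t)⟩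

theorem D_time : D time = 1 := by
  ext t
  exact D_apply_of_hasDerivAt (hasDerivAt_id t)

/-- For `a` in an abelian ideal, `[g, a]` lies in the ideal as well, so `[a, [g, a]] = 0` for every
`g`. The choices `g = 1, t, t²` already force `a² = 0`, hence `a = 0`. -/
instance : LieAlgebra.HasTrivialRadical ℝ Vir := by
  rw [LieAlgebra.hasTrivialRadical_iff_no_abelian_ideals]
  intro I hI
  rw [eq_bot_iff]
  intro a ha
  have key : ∀ g : C, a.coeff * D (g * D a.coeff - D g * a.coeff)
      - D a.coeff * (g * D a.coeff - D g * a.coeff) = 0 := by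
    intro g
    have hb : ⁅Vir.of g, a⁆ ∈ I := lie_mem_right ℝ Vir I _ _ ha
    have := hI.trivial ⟨a, ha⟩ ⟨_, hb⟩
    have h : ⁅a, ⁅Vir.of g, a⁆⁆ = 0 := congrArg Subtype.val this
    exact congrArg Vir.coeff h
  have k0 := key 1
  have k1 := key time
  have k2 := key (time * time)
  simp only [D_mul, map_sub, map_add, D_time, D.map_one_eq_zero, map_zero] at k0 k1 k2
  have hsq : a.coeff * a.coeff = 0 := by
    ext t
    have e0 := congrArg (fun f : C => f.1 t) k0
    have e1 := congrArg (fun f : C => f.1 t) k1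
    have e2 := congrArg (fun f : C => f.1 t) k2
    have o : (1 : C).1 t = 1 := rfl
    simp only [C.add_apply, C.sub_apply, C.mul_apply, C.zero_apply, o] at e0 e1 e2 ⊢
    -- The three left-hand sides are `e₀ = aa'' - a'²`, `e₁ = t e₀ + aa'` and `e₂ = t² e₀ + 2t aa' -
    -- 2a²`; this eliminates `e₀` and `aa'`.
    linear_combination (-e2 + 2 * time.1 t * e1 - time.1 t ^ 2 * e0) / 2
  have h0 : a.coeff = 0 := by
    ext t
    have := congrArg (fun f : C => f.1 t) hsq
    simpa using this
  exact Vir.coeff.injective (h0.trans (map_zero _).symm)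

/-! ### Solvable ideals and radicals -/

/-- Surjectivity makes `I.map π`, defined as a generated ideal, equal to the set-theoretic image, so
it is a quotient of `I`. -/
theorem isSolvable_map {L M : Type} [LieRing L] [LieAlgebra ℝ L] [LieRing M] [LieAlgebra ℝ M]
    (π : L →ₗ⁅ℝ⁆ M) (hπ : Function.Surjective π) (I : LieIdeal ℝ L) [LieAlgebra.IsSolvable I] :
    LieAlgebra.IsSolvable (I.map π) := by
  let f : I →ₗ⁅ℝ⁆ (I.map π) :=
    { toFun := fun x => ⟨π x, LieIdeal.mem_map x.2⟩
      map_add' := fun x y => Subtype.ext (map_add π x.1 y.1)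
      map_smul' := fun c x => Subtype.ext (map_smul π c x.1)
      map_lie' := fun {x y} => Subtype.ext (LieHom.map_lie π x.1 y.1) }
  refine Function.Surjective.lieAlgebra_isSolvable (f := f) ?_
  rintro ⟨y, hy⟩
  obtain ⟨x, rfl⟩ := LieIdeal.mem_map_of_surjective hπ hy
  exact ⟨x, rfl⟩

/-- A solvable ideal is the radical if it is the kernel of a surjection to a Lie algebra without
solvable ideals. -/
theorem radical_eq_of_ker {L M : Type} [LieRing L] [LieAlgebra ℝ L] [LieRing M] [LieAlgebra ℝ M]
    [LieAlgebra.HasTrivialRadical ℝ M] (π : L →ₗ⁅ℝ⁆ M) (hπ : Function.Surjective π)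
    (𝔫 : LieIdeal ℝ L) [hs : LieAlgebra.IsSolvable 𝔫] (h : ∀ v, v ∈ 𝔫 ↔ π v = 0) :
    LieAlgebra.radical ℝ L = 𝔫 := by
  refine le_antisymm (sSup_le fun I hI => ?_) (le_sSup hs)
  have : LieAlgebra.IsSolvable I := hI
  have := isSolvable_map π hπ I
  have e := LieAlgebra.HasTrivialRadical.eq_bot_of_isSolvable (I.map π)
  intro v hv
  have hm : π v ∈ I.map π := LieIdeal.mem_map hv
  rw [e] at hm
  exact (h v).2 hm

/-- An injective map has the solvable ideal `⊥` as its kernel, so `radical_eq_of_ker` applies. -/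
theorem hasTrivialRadical_of_bijective {L M : Type} [LieRing L] [LieAlgebra ℝ L] [LieRing M]
    [LieAlgebra ℝ M] [LieAlgebra.HasTrivialRadical ℝ M] (π : L →ₗ⁅ℝ⁆ M)
    (hπ : Function.Bijective π) : LieAlgebra.HasTrivialRadical ℝ L :=
  ⟨radical_eq_of_ker π hπ.2 ⊥ fun v => by
    rw [LieSubmodule.mem_bot, map_eq_zero_iff π hπ.1]⟩

theorem isSolvable_of_lie_lie {L : Type} [LieRing L] [LieAlgebra ℝ L] {I J : LieIdeal ℝ L}
    (h : ∀ x ∈ I, ∀ y ∈ I, ⁅x, y⁆ ∈ J) (h' : ∀ x ∈ J, ∀ y ∈ J, ⁅x, y⁆ = 0) :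
    LieAlgebra.IsSolvable I := by
  refine LieAlgebra.IsSolvable.mk (R := ℝ) (k := 2) ?_
  rw [LieAlgebra.derivedSeries_def, LieIdeal.derivedSeries_eq_bot_iff,
    LieAlgebra.derivedSeriesOfIdeal_succ, LieAlgebra.derivedSeriesOfIdeal_succ,
    LieAlgebra.derivedSeriesOfIdeal_zero, eq_bot_iff]
  have hIJ : ⁅I, I⁆ ≤ J := (LieSubmodule.lie_le_iff _ _ _).2 h
  refine (LieSubmodule.lie_le_iff _ _ _).2 fun x hx y hy => ?_
  rw [h' x (hIJ hx) y (hIJ hy)]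
  exact zero_mem _

/-- The polynomials embed into the smooth functions. -/
theorem not_finiteDimensional_C : ¬ FiniteDimensional ℝ C := by
  intro h
  let f : Polynomial ℝ →ₗ[ℝ] C :=
    { toFun := fun p => ⟨fun t => p.eval t, by
        change ContDiff ℝ ∞ fun t : ℝ => p.eval t
        simpa using Polynomial.contDiff_aeval (𝕜 := ℝ) p ∞⟩
      map_add' := fun p q => by ext t; exact Polynomial.eval_add
      map_smul' := fun c p => by ext t; exact Polynomial.eval_smul ..}
  have hf : Function.Injective f := by
    intro p q hpq
    exact Polynomial.funext fun t => congrArg (fun g : C => g.1 t) hpq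
  exact Polynomial.not_finite (Module.Finite.of_injective f hf)

attribute [local instance 100] LieRing.ofAssociativeRing LieAlgebra.ofAssociativeAlgebra

/-! ### The embedding into a Kac–Moody–Virasoro algebra

In the case `δ₁ = -ε₁` the general element acts on the `C^∞(ℝ)`-module with the basis
`1, x, y, x y, x² + ε₁ y², x² y + (ε₁/3) y³, φ, θ`, where `θ` is the argument of `ψ`. -/

/-- The six functions that determine a general element. -/
abbrev Coeffs : Type := C × C × C × C × C × C

/-- The matrix of a general element, with the multiple `-(τ'/2)` of the identity added, which makes
it trace-free. -/
def currentMatrix (ε₁ : ℝ) (c : Coeffs) : Matrix (Fin 8) (Fin 8) C :=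
  let τ := c.1; let α := c.2.1; let β := c.2.2.1
  let μ := c.2.2.2.1; let γ := c.2.2.2.2.1; let δ := c.2.2.2.2.2
  !![-(1 / 2 : ℝ) • D τ, α, β, 0, 0, 0, δ, -μ;
    0, 0, 0, β, (2 : ℝ) • α, 0, γ, (1 / 2 : ℝ) • D α;
    0, 0, 0, α, (2 * ε₁) • β, 0, D μ, (ε₁ / 2) • D β;
    0, 0, 0, (1 / 2 : ℝ) • D τ, 0, (2 : ℝ) • α, -(1 / 2 : ℝ) • D (D α), 0;
    0, 0, 0, 0, (1 / 2 : ℝ) • D τ, β, -(1 / 4 : ℝ) • D (D β), (1 / 8 : ℝ) • D (D τ);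
    0, 0, 0, 0, 0, D τ, -(1 / 8 : ℝ) • D (D (D τ)), 0;
    0, 0, 0, 0, 0, 0, -D τ, 0;
    0, 0, 0, 0, 0, 0, 0, -(1 / 2 : ℝ) • D τ]

/-- In units of `τ'`, the weights of the eight basis functions are `0, 1/2, 1/2, 1, 1, 3/2, -1/2,
0`. Their sum 4 is cancelled by subtracting `1/2` eight times. -/
theorem trace_currentMatrix (ε₁ : ℝ) (c : Coeffs) : (currentMatrix ε₁ c).trace = 0 := by
  simp only [Matrix.trace, Fin.sum_univ_eight, Matrix.diag_apply]
  ext t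
  simp [currentMatrix]

/-- The commutator of general elements in terms of the six functions, in the case `δ₁ = -ε₁`. -/
def lieCoeffs (ε₁ : ℝ) (c c' : Coeffs) : Coeffs :=
  let τ := c.1; let α := c.2.1; let β := c.2.2.1
  let μ := c.2.2.2.1; let γ := c.2.2.2.2.1; let δ := c.2.2.2.2.2
  let τ' := c'.1; let α' := c'.2.1; let β' := c'.2.2.1
  let μ' := c'.2.2.2.1; let γ' := c'.2.2.2.2.1; let δ' := c'.2.2.2.2.2
  (τ * D τ' - D τ * τ',
    τ * D α' - (1 / 2 : ℝ) • (D τ * α') - (τ' * D α - (1 / 2 : ℝ) • (D τ' * α)),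
    τ * D β' - (1 / 2 : ℝ) • (D τ * β') - (τ' * D β - (1 / 2 : ℝ) • (D τ' * β)),
    τ * D μ' - τ' * D μ - (1 / 2 : ℝ) • (α * D α' - D α * α')
      - (ε₁ / 2) • (β * D β' - D β * β'),
    τ * D γ' + D τ * γ' - (τ' * D γ + D τ' * γ)
      + (1 / 2 : ℝ) • (D (D α) * β' + (-ε₁ * ε₁) • (α * D (D β')))
      - (1 / 2 : ℝ) • (D (D α') * β + (-ε₁ * ε₁) • (α' * D (D β))),
    τ * D δ' + (1 / 2 : ℝ) • (D τ * δ') - (τ' * D δ + (1 / 2 : ℝ) • (D τ' * δ))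
      + α * γ' - α' * γ + β * D μ' - β' * D μ)

/-- The matrix of a general element, applied to a vector. -/
theorem currentMatrix_mulVec (ε₁ : ℝ) (τ α β μ γ δ : C) (v : Fin 8 → C) :
    (currentMatrix ε₁ (τ, α, β, μ, γ, δ)).mulVec v =
      ![-(1 / 2 : ℝ) • D τ * v 0 + α * v 1 + β * v 2 + δ * v 6 - μ * v 7,
        β * v 3 + (2 : ℝ) • α * v 4 + γ * v 6 + (1 / 2 : ℝ) • D α * v 7,
        α * v 3 + (2 * ε₁) • β * v 4 + D μ * v 6 + (ε₁ / 2) • D β * v 7,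
        (1 / 2 : ℝ) • D τ * v 3 + (2 : ℝ) • α * v 5 - (1 / 2 : ℝ) • D (D α) * v 6,
        (1 / 2 : ℝ) • D τ * v 4 + β * v 5 - (1 / 4 : ℝ) • D (D β) * v 6
          + (1 / 8 : ℝ) • D (D τ) * v 7,
        D τ * v 5 - (1 / 8 : ℝ) • D (D (D τ)) * v 6,
        -D τ * v 6,
        -(1 / 2 : ℝ) • D τ * v 7] := by
  ext i t
  fin_cases i <;>
    simp [currentMatrix, Matrix.mulVec, dotProduct, Fin.sum_univ_eight] <;> ring

theorem currentMatrix_add (ε₁ : ℝ) (c c' : Coeffs) :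
    currentMatrix ε₁ (c + c') = currentMatrix ε₁ c + currentMatrix ε₁ c' := by
  obtain ⟨τ, α, β, μ, γ, δ⟩ := c
  obtain ⟨τ', α', β', μ', γ', δ'⟩ := c'
  apply Matrix.mulVec_injective
  funext v
  simp only [Matrix.add_mulVec, Prod.mk_add_mk, currentMatrix_mulVec]
  ext i t
  fin_cases i <;> dsimp <;>
    simp only [map_add, C.add_apply] <;> ring

theorem currentMatrix_smul (ε₁ r : ℝ) (c : Coeffs) :
    currentMatrix ε₁ (r • c) = r • currentMatrix ε₁ c := by
  obtain ⟨τ, α, β, μ, γ, δ⟩ := c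
  apply Matrix.mulVec_injective
  funext v
  simp only [Matrix.smul_mulVec, Prod.smul_mk, currentMatrix_mulVec]
  ext i t
  fin_cases i <;> dsimp <;>
    simp only [D.map_smul, C.smul_apply] <;> ring

/-- The entries are linear in the six functions and their derivatives with constant coefficients, so
differentiating them amounts to differentiating the functions. -/
theorem currentMatrix_map (ε₁ : ℝ) (τ α β μ γ δ f : C) :
    (currentMatrix ε₁ (τ, α, β, μ, γ, δ)).map (fun g => f * D g) =
      f • currentMatrix ε₁ (D τ, D α, D β, D μ, D γ, D δ) := by
  have h : ∀ g : C, f * D g = f • D g := fun g => rfl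
  simp only [h]
  ext1 i j
  rw [Matrix.map_apply, Matrix.smul_apply]
  congr 1
  fin_cases i <;> fin_cases j <;>
    first
      | exact map_zero D
      | rfl
      | exact map_neg D _
      | exact D.map_smul _ _

/-- This is the commutator of the operators `τ d/dt + A` and `τ' d/dt + A'`, where the prime marks
the second element. Applying both sides to an arbitrary vector replaces matrix products by two
successive applications of the explicit action. -/
theorem currentMatrix_lieCoeffs {ε₁ : ℝ} (hε₁ : ε₁ = 1 ∨ ε₁ = -1) (c c' : Coeffs) :
    currentMatrix ε₁ (lieCoeffs ε₁ c c') =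
      currentMatrix ε₁ c * currentMatrix ε₁ c' - currentMatrix ε₁ c' * currentMatrix ε₁ c
        + (currentMatrix ε₁ c').map (fun f => c.1 * D f)
        - (currentMatrix ε₁ c).map (fun f => c'.1 * D f) := by
  obtain ⟨τ, α, β, μ, γ, δ⟩ := c
  obtain ⟨τ', α', β', μ', γ', δ'⟩ := c'
  apply Matrix.mulVec_injective
  funext v
  rw [currentMatrix_map, currentMatrix_map, Matrix.sub_mulVec, Matrix.add_mulVec,
    Matrix.sub_mulVec, ← Matrix.mulVec_mulVec, ← Matrix.mulVec_mulVec, Matrix.smul_mulVec,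
    Matrix.smul_mulVec]
  simp only [lieCoeffs, currentMatrix_mulVec]
  ext i t
  fin_cases i <;> dsimp <;>
    simp only [D_mul, map_add, map_sub, D.map_smul, C.add_apply, C.sub_apply, C.mul_apply,
      C.smul_apply] <;>
    rcases hε₁ with rfl | rfl <;> ring

/-! ### The Levi decomposition and the Kac–Moody–Virasoro structure -/

section levi

variable {ε₁ : ℝ} (hε₁ : ε₁ = 1 ∨ ε₁ = -1)

/-- The parametrization of the symmetry algebra by six functions, in the case `δ₁ = -ε₁`. -/
def ofCoeffs : Coeffs →ₗ[ℝ] symmetryAlgebra hε₁ (-ε₁) where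
  toFun c := ⟨G ε₁ (-ε₁) c.1 c.2.1 c.2.2.1 c.2.2.2.1 c.2.2.2.2.1 c.2.2.2.2.2,
    _, _, _, _, _, _, by simp, rfl⟩
  map_add' c c' := Subtype.ext (G_add hε₁ ..).symm
  map_smul' r c := Subtype.ext (G_smul hε₁ ..).symm

theorem ofCoeffs_bijective : Function.Bijective (ofCoeffs hε₁) := by
  constructor
  · rintro ⟨τ, α, β, μ, γ, δ⟩ ⟨τ', α', β', μ', γ', δ'⟩ h
    obtain ⟨rfl, rfl, rfl, rfl, rfl, rfl⟩ := G_injective hε₁ (-ε₁) (congrArg Subtype.val h)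
    rfl
  · rintro ⟨_, τ, α, β, μ, γ, δ, -, rfl⟩
    exact ⟨(τ, α, β, μ, γ, δ), rfl⟩

/-- The symmetry algebra as the space of sextuples of functions, in the case `δ₁ = -ε₁`. -/
def coeffEquiv : Coeffs ≃ₗ[ℝ] symmetryAlgebra hε₁ (-ε₁) :=
  LinearEquiv.ofBijective (ofCoeffs hε₁) (ofCoeffs_bijective hε₁)

theorem lie_coeffEquiv (c c' : Coeffs) :
    ⁅coeffEquiv hε₁ c, coeffEquiv hε₁ c'⁆ = coeffEquiv hε₁ (lieCoeffs ε₁ c c') :=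
  Subtype.ext (lie_G hε₁ _ _ _ _ _ _ _ _ _ _ (by simp) (by simp))

theorem coeffEquiv_symm_lie (v v' : symmetryAlgebra hε₁ (-ε₁)) :
    (coeffEquiv hε₁).symm ⁅v, v'⁆
      = lieCoeffs ε₁ ((coeffEquiv hε₁).symm v) ((coeffEquiv hε₁).symm v') := by
  rw [LinearEquiv.symm_apply_eq, ← lie_coeffEquiv, LinearEquiv.apply_symm_apply,
    LinearEquiv.apply_symm_apply]

/-- The embedding of the symmetry algebra into a Kac–Moody–Virasoro algebra. -/
def toKMV : symmetryAlgebra hε₁ (-ε₁) →ₗ⁅ℝ⁆ KMV 8 where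
  toFun v := ⟨⟨currentMatrix ε₁ ((coeffEquiv hε₁).symm v), trace_currentMatrix _ _⟩,
    Vir.of ((coeffEquiv hε₁).symm v).1⟩
  map_add' v v' := by
    refine LieAlgebra.SemiDirectSum.ext (Subtype.ext ?_) ?_
    · change currentMatrix ε₁ _ = currentMatrix ε₁ _ + currentMatrix ε₁ _
      rw [map_add, currentMatrix_add]
    · change Vir.of _ = Vir.of _ + Vir.of _
      rw [map_add, Prod.fst_add, map_add]
  map_smul' r v := by
    refine LieAlgebra.SemiDirectSum.ext (Subtype.ext ?_) ?_
    · change currentMatrix ε₁ _ = r • currentMatrix ε₁ _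
      rw [map_smul, currentMatrix_smul]
    · change Vir.of _ = r • Vir.of _
      rw [map_smul, Prod.smul_fst, map_smul]
  map_lie' {v v'} := by
    refine LieAlgebra.SemiDirectSum.ext (Subtype.ext ?_) ?_
    · refine Eq.trans ?_ (currentMatrix_lieCoeffs hε₁ ((coeffEquiv hε₁).symm v)
        ((coeffEquiv hε₁).symm v'))
      exact congrArg (currentMatrix ε₁) (coeffEquiv_symm_lie hε₁ v v')
    · exact congrArg (fun c : Coeffs => Vir.of c.1) (coeffEquiv_symm_lie hε₁ v v')

theorem toKMV_injective : Function.Injective (toKMV hε₁) := by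
  intro v v' h
  apply (coeffEquiv hε₁).symm.injective
  have hr : ((coeffEquiv hε₁).symm v).1 = ((coeffEquiv hε₁).symm v').1 :=
    congrArg LieAlgebra.SemiDirectSum.right h
  have hl : currentMatrix ε₁ ((coeffEquiv hε₁).symm v)
      = currentMatrix ε₁ ((coeffEquiv hε₁).symm v') :=
    congrArg (fun a : KMV 8 => a.left.1) h
  -- The Virasoro component gives `τ`; the entries `(0,1), (0,2), (0,7), (1,6), (0,6)` are `α, β,
  -- -μ, γ, δ`.
  have e : ∀ i j, _ := fun i j => congrFun (congrFun hl i) j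
  exact Prod.ext hr (Prod.ext (e 0 1) (Prod.ext (e 0 2) (Prod.ext (neg_injective (e 0 7))
    (Prod.ext (e 1 6) (e 0 6)))))

/-- The projection of the symmetry algebra to the Virasoro algebra. -/
def toVir : symmetryAlgebra hε₁ (-ε₁) →ₗ⁅ℝ⁆ Vir :=
  (LieAlgebra.SemiDirectSum.projr (Vir.act 8)).comp (toKMV hε₁)

theorem toVir_coeffEquiv (c : Coeffs) : toVir hε₁ (coeffEquiv hε₁ c) = Vir.of c.1 :=
  congrArg (fun c : Coeffs => Vir.of c.1) ((coeffEquiv hε₁).symm_apply_apply c)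

/-- The subalgebra `{X(τ)}`. -/
def leviFactor : LieSubalgebra ℝ (symmetryAlgebra hε₁ (-ε₁)) where
  carrier := {v | ∃ τ : C, v = coeffEquiv hε₁ (τ, 0)}
  add_mem' := by
    rintro _ _ ⟨τ, rfl⟩ ⟨τ', rfl⟩
    exact ⟨τ + τ', by rw [← map_add, Prod.mk_add_mk, add_zero]⟩
  zero_mem' := ⟨0, (map_zero _).symm⟩
  smul_mem' := by
    rintro r _ ⟨τ, rfl⟩
    exact ⟨r • τ, by rw [← map_smul, Prod.smul_mk, smul_zero]⟩
  lie_mem' := by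
    rintro _ _ ⟨τ, rfl⟩ ⟨τ', rfl⟩
    refine ⟨τ * D τ' - D τ * τ', ?_⟩
    rw [lie_coeffEquiv]
    congr 1
    simp [lieCoeffs, Prod.ext_iff]

/-- The ideal of the elements with `τ = 0`. -/
def solvableIdeal : LieIdeal ℝ (symmetryAlgebra hε₁ (-ε₁)) := (toVir hε₁).ker

theorem coeffEquiv_mem_solvableIdeal (c : Coeffs) :
    coeffEquiv hε₁ c ∈ solvableIdeal hε₁ ↔ c.1 = 0 := by
  rw [solvableIdeal, LieHom.mem_ker, toVir_coeffEquiv, map_eq_zero_iff _ Vir.of.injective]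

/-- The abelian ideal of the elements with `τ = α = β = 0`. -/
def abelianIdeal : LieIdeal ℝ (symmetryAlgebra hε₁ (-ε₁)) where
  carrier := {v | ∃ μ γ δ : C, v = coeffEquiv hε₁ (0, 0, 0, μ, γ, δ)}
  add_mem' := by
    rintro _ _ ⟨μ, γ, δ, rfl⟩ ⟨μ', γ', δ', rfl⟩
    exact ⟨μ + μ', γ + γ', δ + δ', by rw [← map_add]; simp⟩
  zero_mem' := ⟨0, 0, 0, (map_zero _).symm⟩
  smul_mem' := by
    rintro r _ ⟨μ, γ, δ, rfl⟩
    exact ⟨r • μ, r • γ, r • δ, by rw [← map_smul]; simp⟩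
  lie_mem := by
    rintro v _ ⟨μ, γ, δ, rfl⟩
    obtain ⟨c, rfl⟩ := (coeffEquiv hε₁).surjective v
    refine ⟨_, _, _, (lie_coeffEquiv hε₁ _ _).trans (congrArg (coeffEquiv hε₁) (Prod.ext ?_
      (Prod.ext ?_ (Prod.ext ?_ (Prod.ext rfl (Prod.ext rfl rfl))))))⟩ <;> simp [lieCoeffs]

/-- With `τ = 0`, brackets of the `Y` and `Z` produce only `W` and `R`, so the derived algebra lies
in the ideal of the `W, R, S`, which commute with each other. -/
theorem isSolvable_solvableIdeal : LieAlgebra.IsSolvable (solvableIdeal hε₁) := by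
  refine isSolvable_of_lie_lie (J := abelianIdeal hε₁) ?_ ?_
  · intro v hv v' hv'
    obtain ⟨c, rfl⟩ := (coeffEquiv hε₁).surjective v
    obtain ⟨c', rfl⟩ := (coeffEquiv hε₁).surjective v'
    rw [coeffEquiv_mem_solvableIdeal] at hv hv'
    refine ⟨_, _, _, (lie_coeffEquiv hε₁ _ _).trans (congrArg (coeffEquiv hε₁) (Prod.ext ?_
      (Prod.ext ?_ (Prod.ext ?_ (Prod.ext rfl (Prod.ext rfl rfl))))))⟩ <;>
      simp [lieCoeffs, hv, hv']
  · rintro _ ⟨μ, γ, δ, rfl⟩ _ ⟨μ', γ', δ', rfl⟩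
    rw [lie_coeffEquiv, map_eq_zero_iff _ (coeffEquiv hε₁).injective]
    simp [lieCoeffs]

theorem toVir_surjective : Function.Surjective (toVir hε₁) := fun a =>
  ⟨coeffEquiv hε₁ (a.coeff, 0), toVir_coeffEquiv hε₁ _⟩

/-- This gives both the trivial radical of `{X(τ)}`, by transport from `Vir`, and the isomorphism
required for the Virasoro part of the embedding. -/
theorem toVir_leviFactor_bijective :
    Function.Bijective fun s : leviFactor hε₁ => toVir hε₁ s := by
  constructor
  · rintro ⟨_, τ, rfl⟩ ⟨_, τ', rfl⟩ h
    simp only [toVir_coeffEquiv] at h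
    obtain rfl : τ = τ' := Vir.of.injective h
    rfl
  · intro a
    exact ⟨⟨_, a.coeff, rfl⟩, toVir_coeffEquiv hε₁ _⟩

theorem isLeviDecomposition : IsLeviDecomposition (leviFactor hε₁) (solvableIdeal hε₁) where
  solvable := isSolvable_solvableIdeal hε₁
  radical_eq :=
    have := isSolvable_solvableIdeal hε₁
    radical_eq_of_ker (toVir hε₁) (toVir_surjective hε₁) _ fun _ => LieHom.mem_ker ..
  semisimple := hasTrivialRadical_of_bijective ((toVir hε₁).comp (leviFactor hε₁).incl)
    (toVir_leviFactor_bijective hε₁)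
  isCompl := by
    refine ⟨Submodule.disjoint_def.2 ?_, codisjoint_iff.2 (eq_top_iff.2 fun v _ => ?_)⟩
    · rintro _ ⟨τ, rfl⟩ h
      have h0 : τ = 0 := (coeffEquiv_mem_solvableIdeal hε₁ _).1 h
      rw [h0]
      exact map_zero _
    · obtain ⟨c, rfl⟩ := (coeffEquiv hε₁).surjective v
      refine Submodule.mem_sup.2 ⟨_, ⟨c.1, rfl⟩, coeffEquiv hε₁ (0, c.2),
        (coeffEquiv_mem_solvableIdeal hε₁ _).2 rfl, ?_⟩
      rw [← map_add]
      simp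

theorem not_finiteDimensional_solvableIdeal : ¬ FiniteDimensional ℝ (solvableIdeal hε₁) := by
  intro h
  let f : C →ₗ[ℝ] solvableIdeal hε₁ :=
    { toFun := fun δ => ⟨coeffEquiv hε₁ (0, 0, 0, 0, 0, δ),
        (coeffEquiv_mem_solvableIdeal hε₁ _).2 rfl⟩
      map_add' := fun δ δ' => Subtype.ext ((by simp :
        coeffEquiv hε₁ (0, 0, 0, 0, 0, δ + δ') = coeffEquiv hε₁
          ((0, 0, 0, 0, 0, δ) + (0, 0, 0, 0, 0, δ'))).trans (map_add _ _ _))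
      map_smul' := fun r δ => Subtype.ext ((by simp :
        coeffEquiv hε₁ (0, 0, 0, 0, 0, r • δ) = coeffEquiv hε₁
          (r • (0, 0, 0, 0, 0, δ))).trans (map_smul _ _ _)) }
  have hf : Function.Injective f := by
    intro δ δ' hd
    have := (coeffEquiv hε₁).injective (congrArg (fun x : solvableIdeal hε₁ => x.1) hd)
    simpa using this
  exact not_finiteDimensional_C (Module.Finite.of_injective f hf)

theorem isKacMoodyVirasoro : IsKacMoodyVirasoro (leviFactor hε₁) (solvableIdeal hε₁) :=
  ⟨8, toKMV hε₁, toKMV_injective hε₁, toVir_leviFactor_bijective hε₁,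
    fun _ => LieHom.mem_ker .., not_finiteDimensional_solvableIdeal hε₁⟩

theorem not_finiteDimensional_symmetryAlgebra :
    ¬ FiniteDimensional ℝ (symmetryAlgebra hε₁ (-ε₁)) := fun _ =>
  not_finiteDimensional_solvableIdeal hε₁
    (inferInstanceAs (FiniteDimensional ℝ (solvableIdeal hε₁).toSubmodule))

theorem mem_leviFactor (v : symmetryAlgebra hε₁ (-ε₁)) :
    v ∈ leviFactor hε₁ ↔ ∃ τ : C, (v : VF) = X ε₁ τ := by
  refine exists_congr fun τ => ?_
  rw [X_eq_G ε₁ (-ε₁) τ]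
  exact Subtype.ext_iff

theorem mem_solvableIdeal (v : symmetryAlgebra hε₁ (-ε₁)) :
    v ∈ solvableIdeal hε₁ ↔ ∃ α β μ γ δ : C,
      (v : VF) = Y α + Z ε₁ (-ε₁) β + W μ + R γ + S δ := by
  have hG : ∀ α β μ γ δ : C, Y α + Z ε₁ (-ε₁) β + W μ + R γ + S δ
      = G ε₁ (-ε₁) 0 α β μ γ δ := fun α β μ γ δ => by rw [G, X_zero, zero_add]
  simp only [hG]
  constructor
  · intro h
    obtain ⟨⟨τ, α, β, μ, γ, δ⟩, rfl⟩ := (coeffEquiv hε₁).surjective v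
    obtain rfl : τ = 0 := (coeffEquiv_mem_solvableIdeal hε₁ _).1 h
    exact ⟨α, β, μ, γ, δ, rfl⟩
  · rintro ⟨α, β, μ, γ, δ, h⟩
    obtain rfl : v = coeffEquiv hε₁ (0, α, β, μ, γ, δ) := Subtype.ext h
    exact (coeffEquiv_mem_solvableIdeal hε₁ _).2 rfl

end levi

end DaveyStewartson

end

/-! ### The main theorem -/

open DaveyStewartson in
theorem mainTheorem2 (ε₁ ε₂ δ₁ δ₂ : ℝ)
    (hε₁ : ε₁ = 1 ∨ ε₁ = -1) (hε₂ : ε₂ = 1 ∨ ε₂ = -1) :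
    -- the infinitesimal symmetries form a Lie algebra `L`
    ∃ L : LieSubalgebra ℝ VF,
      (∀ V : VF, V ∈ L ↔ IsSymmetry ε₁ ε₂ δ₁ δ₂ V) ∧
      -- its elements, for every `δ₁`
      (∀ V : VF, V ∈ L ↔ ∃ τ α β μ γ δ : C, (ε₁ + δ₁) • D (D (D τ)) = 0 ∧
        V = X ε₁ τ + Y α + Z ε₁ δ₁ β + W μ + R γ + S δ) ∧
      -- the six functions are determined by the vector field
      (∀ τ α β μ γ δ τ' α' β' μ' γ' δ' : C,
        X ε₁ τ + Y α + Z ε₁ δ₁ β + W μ + R γ + S δ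
            = X ε₁ τ' + Y α' + Z ε₁ δ₁ β' + W μ' + R γ' + S δ' →
          τ = τ' ∧ α = α' ∧ β = β' ∧ μ = μ' ∧ γ = γ' ∧ δ = δ') ∧
      -- the commutators with `X(τ)`
      (∀ τ : C, (ε₁ + δ₁) • D (D (D τ)) = 0 →
        (∀ τ₂ : C, (ε₁ + δ₁) • D (D (D τ₂)) = 0 →
          ⁅X ε₁ τ, X ε₁ τ₂⁆ = X ε₁ (τ * D τ₂ - D τ * τ₂)) ∧
        (∀ α : C, ⁅X ε₁ τ, Y α⁆ = Y (τ * D α - (1 / 2 : ℝ) • (D τ * α))) ∧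
        (∀ β : C, ⁅X ε₁ τ, Z ε₁ δ₁ β⁆ = Z ε₁ δ₁ (τ * D β - (1 / 2 : ℝ) • (D τ * β))) ∧
        (∀ μ : C, ⁅X ε₁ τ, W μ⁆ = W (τ * D μ)) ∧
        (∀ γ : C, ⁅X ε₁ τ, R γ⁆ = R (τ * D γ + D τ * γ)) ∧
        (∀ δ : C, ⁅X ε₁ τ, S δ⁆ = S (τ * D δ + (1 / 2 : ℝ) • (D τ * δ)))) ∧
      -- the other nonzero commutators
      (∀ α₁ α₂ : C, ⁅Y α₁, Y α₂⁆ = -(1 / 2 : ℝ) • W (α₁ * D α₂ - D α₁ * α₂)) ∧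
      (∀ β₁ β₂ : C,
        ⁅Z ε₁ δ₁ β₁, Z ε₁ δ₁ β₂⁆ = -(ε₁ / 2) • W (β₁ * D β₂ - D β₁ * β₂)) ∧
      (∀ α β : C,
        ⁅Y α, Z ε₁ δ₁ β⁆ = (1 / 2 : ℝ) • R (D (D α) * β + (δ₁ * ε₁) • (α * D (D β)))) ∧
      (∀ α γ : C, ⁅Y α, R γ⁆ = S (α * γ)) ∧
      (∀ β μ : C, ⁅Z ε₁ δ₁ β, W μ⁆ = S (β * D μ)) ∧
      -- the vanishing commutators
      (∀ f g : C, ⁅Y f, W g⁆ = 0 ∧ ⁅Y f, S g⁆ = 0 ∧ ⁅Z ε₁ δ₁ f, R g⁆ = 0 ∧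
        ⁅Z ε₁ δ₁ f, S g⁆ = 0 ∧ ⁅W f, W g⁆ = 0 ∧ ⁅W f, R g⁆ = 0 ∧ ⁅W f, S g⁆ = 0 ∧
        ⁅R f, R g⁆ = 0 ∧ ⁅R f, S g⁆ = 0 ∧ ⁅S f, S g⁆ = 0) ∧
      -- the case `δ₁ = -ε₁`
      (δ₁ = -ε₁ →
        (∀ V : VF, V ∈ L ↔ ∃ τ α β μ γ δ : C,
          V = X ε₁ τ + Y α + Z ε₁ δ₁ β + W μ + R γ + S δ) ∧
        ¬ FiniteDimensional ℝ L ∧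
        ∃ (𝔰 : LieSubalgebra ℝ L) (𝔫 : LieIdeal ℝ L),
          (∀ v : L, v ∈ 𝔰 ↔ ∃ τ : C, (v : VF) = X ε₁ τ) ∧
          (∀ v : L, v ∈ 𝔫 ↔ ∃ α β μ γ δ : C,
            (v : VF) = Y α + Z ε₁ δ₁ β + W μ + R γ + S δ) ∧
          IsLeviDecomposition 𝔰 𝔫 ∧ IsKacMoodyVirasoro 𝔰 𝔫) ∧
      -- the case `δ₁ ≠ -ε₁`
      (δ₁ ≠ -ε₁ →
        ∀ V : VF, V ∈ L ↔ ∃ τ α β μ γ δ : C,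
          (∃ τ₀ τ₁ τ₂ : ℝ, ∀ t : ℝ, τ.1 t = τ₂ * t ^ 2 + τ₁ * t + τ₀) ∧
          V = X ε₁ τ + Y α + Z ε₁ δ₁ β + W μ + R γ + S δ) := by
  refine ⟨symmetryAlgebra hε₁ δ₁, fun V => ⟨?_, fun hV => exists_G_of_isSymmetry hε₁ hε₂ hV⟩,
    fun V => Iff.rfl, fun τ α β μ γ δ τ' α' β' μ' γ' δ' h => G_injective hε₁ δ₁ h,
    fun τ hτ => ⟨fun τ₂ hτ₂ => lie_X_X hε₁ δ₁ hτ hτ₂, lie_X_Y hε₁ δ₁ hτ, lie_X_Z hε₁ δ₁ hτ,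
      lie_X_W hε₁ δ₁ hτ, lie_X_R hε₁ δ₁ hτ, lie_X_S hε₁ δ₁ hτ⟩,
    lie_Y_Y hε₁, lie_Z_Z hε₁ δ₁, lie_Y_Z hε₁ δ₁, lie_Y_R hε₁, lie_Z_W hε₁ δ₁,
    lie_eq_zero hε₁ δ₁, ?_, ?_⟩
  · rintro ⟨τ, α, β, μ, γ, δ, hτ, rfl⟩
    exact isSymmetry_G hε₁ ε₂ δ₂ α β μ γ δ hτ
  · rintro rfl
    refine ⟨fun V => ⟨?_, ?_⟩, not_finiteDimensional_symmetryAlgebra hε₁, leviFactor hε₁,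
      solvableIdeal hε₁, mem_leviFactor hε₁, mem_solvableIdeal hε₁, isLeviDecomposition hε₁,
      isKacMoodyVirasoro hε₁⟩
    · rintro ⟨τ, α, β, μ, γ, δ, -, h⟩
      exact ⟨τ, α, β, μ, γ, δ, h⟩
    · rintro ⟨τ, α, β, μ, γ, δ, h⟩
      exact ⟨τ, α, β, μ, γ, δ, by simp, h⟩
  · intro hδ V
    have hne : ε₁ + δ₁ ≠ 0 := fun h => hδ (by linarith)
    constructor
    · rintro ⟨τ, α, β, μ, γ, δ, hτ, h⟩
      exact ⟨τ, α, β, μ, γ, δ,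
        eq_quadratic_of_D_D_D_eq_zero ((smul_eq_zero.1 hτ).resolve_left hne), h⟩
    · rintro ⟨τ, α, β, μ, γ, δ, ⟨τ₀, τ₁, τ₂, hτ⟩, h⟩
      exact ⟨τ, α, β, μ, γ, δ, by rw [D_D_D_eq_zero_of_quadratic hτ, smul_zero], h⟩
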